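/- Setting. Write $\mathbb S^2$ for the unit sphere of $\mathbb R^3$ with spherical distance $d$, identified with $\hat{\mathbb C}=\partial\mathbb H^3$. A disk is a closed spherical ball $D=\{x\in\mathbb S^2: d(x,z)\le r\}$ with $z\in\mathbb S^2$ and $0<r<\pi$. Let $T$ be a triangulation of the sphere with vertex set $V$, and let $\mathcal P=\{D(v)\}_{v\in V}$ be a family of disks. Its contact graph joins distinct vertices $u,w$ when $D(u)\cap D(w)\ne\emptyset$. For an edge $e=[u,w]$, the overlap angle of the disks with centres $z_u,z_w$ and radii $r_u,r_w$ is $$\Theta(e)=\arccos\frac{\cos r_u\cos r_w-\cos d(z_u,z_w)}{\sin r_u\sin r_w}.$$ Let $H(v)\subset\mathbb H^3$ be the closed convex hull of the ideal points in $\mathbb S^2\setminus D(v)$ (a closed half-space), let $\Pi(v)$ be its boundary plane in $\mathbb H^3$, and put $Q(\mathcal P)=\bigcap_{v\in V}H(v)$. Theorem 3.1. Let $T$ be a triangulation of the sphere with more than four vertices, and let $\mathcal P=\{D(v)\}_{v\in V}$ be a circle pattern whose contact graph is the $1$-skeleton of $T$ (with $D(v)$ corresponding to the vertex $v$). Assume: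 (c2) if $e_1,e_2,e_3$ form the boundary of a triangle of $T$, then $\Theta(e_1)+\Theta(e_2)+\Theta(e_3)>\pi$, $\Theta(e_1)+\Theta(e_2)<\Theta(e_3)+\pi$, $\Theta(e_2)+\Theta(e_3)<\Theta(e_1)+\pi$ and $\Theta(e_3)+\Theta(e_1)<\Theta(e_2)+\pi$; (cr) whenever the edges $[v_\alpha,v_\beta],[v_\beta,v_\gamma],[v_\gamma,v_\alpha]$ form a simple closed curve separating the vertices of $T$, then $D(v_\alpha)\cap D(v_\beta)\cap D(v_\gamma)=\emptyset$. Then $Q(\mathcal P)$ is a compact convex polyhedron in $\mathbb H^3$ with non-empty interior. Its boundary decomposition is dual to $T$: the map sending a simplex $s$ of $T$ to $Q(\mathcal P)\cap\bigcap_{v\in s}\Pi(v)$ is an inclusion-reversing bijection from the simplices of $T$ onto the non-empty proper faces of $Q(\mathcal P)$, taking vertices, edges and triangles of $T$ to faces of dimension $2$, $1$ and $0$ respectively, and the boundary of $Q(\mathcal P)$ is the union of its $2$-dimensional faces. For every edge $e=[u,w]$ of $T$, the dihedral angle of $Q(\mathcal P)$ along the edge $Q(\mathcal P)\cap\Pi(u)\cap\Pi(w)$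 equals $\Theta(e)$. -/

import Mathlib

namespace CirclePattern

noncomputable section

/-! ### Triangulations of the sphere -/

/-- The `1`-skeleton of a simplicial complex, as a simple graph on its vertex set. -/
def oneSkeleton {V : Type*} [DecidableEq V] (T : AbstractSimplicialComplex V) :
    SimpleGraph V where
  Adj u w := u ≠ w ∧ ({u, w} : Finset V) ∈ T.faces
  symm := ⟨fun u w h => ⟨h.1.symm, by rw [Finset.pair_comm]; exact h.2⟩⟩
  loopless := ⟨fun _ h => h.1 rfl⟩

/-- The link of the vertex `v`, as a graph on the set of neighbours of `v`: two neighbours `a`, `b`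
of `v` are joined when `v, a, b` span a triangle. -/
def link {V : Type*} [DecidableEq V] (T : AbstractSimplicialComplex V) (v : V) :
    SimpleGraph {w : V // (oneSkeleton T).Adj v w} where
  Adj a b := a ≠ b ∧ ({v, a.1, b.1} : Finset V) ∈ T.faces
  symm := ⟨fun a b h => ⟨h.1.symm, by rw [Finset.pair_comm]; exact h.2⟩⟩
  loopless := ⟨fun _ h => h.1 rfl⟩

/-- A finite simplicial complex is a triangulation of the sphere: it is a connected combinatorial
closed surface (every simplex lies in a triangle, every edge lies in exactly two triangles, and
every vertex link is connected, hence is a cycle) of Euler characteristic `2`. -/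
structure IsSphereTriangulation {V : Type*} [Fintype V] [DecidableEq V]
    (T : AbstractSimplicialComplex V) : Prop where
  card_le : ∀ s ∈ T.faces, s.card ≤ 3
  pure : ∀ s ∈ T.faces, ∃ t ∈ T.faces, s ⊆ t ∧ t.card = 3
  edge_two : ∀ e ∈ T.faces, e.card = 2 → {t | t ∈ T.faces ∧ t.card = 3 ∧ e ⊆ t}.ncard = 2
  link_connected : ∀ v : V, (link T v).Connected
  connected : (oneSkeleton T).Connected
  euler : {s | s ∈ T.faces ∧ s.card = 1}.ncard + {s | s ∈ T.faces ∧ s.card = 3}.ncard =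
    {s | s ∈ T.faces ∧ s.card = 2}.ncard + 2

/-- The edges `[a, b]`, `[b, c]`, `[c, a]` form a simple closed curve that separates the vertices:
among the vertices off the curve, two cannot be joined by an edge path that avoids the curve. -/
def IsSeparatingThreeCycle {V : Type*} [DecidableEq V] (T : AbstractSimplicialComplex V)
    (a b c : V) : Prop :=
  (oneSkeleton T).Adj a b ∧ (oneSkeleton T).Adj b c ∧ (oneSkeleton T).Adj c a ∧
    ¬ ((oneSkeleton T).induce ({a, b, c} : Set V)ᶜ).Preconnected

/-! ### Circle patterns on the unit sphere -/

/-- Euclidean three-space. Its unit sphere is the Riemann sphere with the spherical metric, and its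
open unit ball is the Klein model of hyperbolic three-space, with the unit sphere as its sphere at
infinity. -/
abbrev E3 : Type := EuclideanSpace ℝ (Fin 3)

/-- The unit sphere. -/
def S2 : Set E3 := Metric.sphere 0 1

/-- The open unit ball: the Klein model of hyperbolic three-space. Its geodesics are the Euclidean
segments, so that hyperbolic convexity is Euclidean convexity. -/
def H3 : Set E3 := Metric.ball 0 1

/-- The centre and the radius of a closed disk on the sphere. -/
structure SphericalDisk where
  center : E3
  radius : ℝ
  center_mem : center ∈ S2
  radius_pos : 0 < radius
  radius_lt : radius < Real.pi

namespace SphericalDisk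

/-- The closed disk as a set of points of the sphere; `InnerProductGeometry.angle` is the
spherical distance of unit vectors. -/
def carrier (D : SphericalDisk) : Set E3 :=
  {x | x ∈ S2 ∧ InnerProductGeometry.angle x D.center ≤ D.radius}

/-- The closed half-space of hyperbolic space attached to a disk: the closed convex hull of the
ideal points outside the disk. -/
def halfSpace (D : SphericalDisk) : Set E3 :=
  H3 ∩ closedConvexHull ℝ (S2 \ D.carrier)

/-- The boundary of the half-space in hyperbolic space, a geodesic plane. -/
def plane (D : SphericalDisk) : Set E3 := H3 ∩ frontier D.halfSpace

end SphericalDisk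

/-- The inversive distance of two disks. -/
def inversiveDistance (D D' : SphericalDisk) : ℝ :=
  (Real.cos D.radius * Real.cos D'.radius -
      Real.cos (InnerProductGeometry.angle D.center D'.center)) /
    (Real.sin D.radius * Real.sin D'.radius)

/-- The overlap angle of two disks whose boundary circles cross (inversive distance in `(-1, 1)`)
or are tangent. In all other cases `Real.arccos` gives `0` or `π`; condition `(c2)` below forces all
the angles that occur in it into the open interval `(0, π)`. -/
def overlapAngle (D D' : SphericalDisk) : ℝ := Real.arccos (inversiveDistance D D')

/-- The contact graph of a family of disks. -/
def contactGraph {V : Type*} (P : V → SphericalDisk) : SimpleGraph V where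
  Adj u w := u ≠ w ∧ ((P u).carrier ∩ (P w).carrier).Nonempty
  symm := ⟨fun u w h => ⟨h.1.symm, by rw [Set.inter_comm]; exact h.2⟩⟩
  loopless := ⟨fun _ h => h.1 rfl⟩

/-- Condition `(c2)` on the overlap angles along the boundary of each triangle. -/
def ConditionC2 {V : Type*} [DecidableEq V] (T : AbstractSimplicialComplex V)
    (P : V → SphericalDisk) : Prop :=
  ∀ i j k : V, i ≠ j → j ≠ k → k ≠ i → ({i, j, k} : Finset V) ∈ T.faces →
    Real.pi < overlapAngle (P i) (P j) + overlapAngle (P j) (P k) + overlapAngle (P k) (P i) ∧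
    overlapAngle (P i) (P j) + overlapAngle (P j) (P k) < overlapAngle (P k) (P i) + Real.pi ∧
    overlapAngle (P j) (P k) + overlapAngle (P k) (P i) < overlapAngle (P i) (P j) + Real.pi ∧
    overlapAngle (P k) (P i) + overlapAngle (P i) (P j) < overlapAngle (P j) (P k) + Real.pi

/-- Condition `(cr)`: disks along a separating `3`-cycle have no common point. -/
def ConditionCR {V : Type*} [DecidableEq V] (T : AbstractSimplicialComplex V)
    (P : V → SphericalDisk) : Prop :=
  ∀ a b c : V, IsSeparatingThreeCycle T a b c →
    (P a).carrier ∩ (P b).carrier ∩ (P c).carrier = ∅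

/-- The convex set `Q(P)`: the intersection of the half-spaces of the disks. -/
def Q {V : Type*} (P : V → SphericalDisk) : Set E3 := ⋂ v, (P v).halfSpace

/-- The part of `Q(P)` on the planes of all the vertices of `s`: the cell dual to the simplex
`s`. -/
def dualCell {V : Type*} (P : V → SphericalDisk) (s : Finset V) : Set E3 :=
  Q P ∩ ⋂ v ∈ s, (P v).plane

/-! ### Convex polyhedra in hyperbolic space -/

/-- Closed half-spaces of hyperbolic space, bounded by a geodesic plane. -/
def IsHyperbolicHalfSpace (S : Set E3) : Prop :=
  ∃ (n : E3) (c : ℝ), ‖n‖ = 1 ∧ |c| < 1 ∧ S = {x | x ∈ H3 ∧ inner ℝ n x ≤ c}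

/-- Compact convex polyhedra of hyperbolic space: compact intersections of finitely many closed
half-spaces, with non-empty interior. -/
structure IsCompactConvexPolyhedron (X : Set E3) : Prop where
  exists_halfSpaces : ∃ 𝓗 : Set (Set E3), 𝓗.Finite ∧ (∀ S ∈ 𝓗, IsHyperbolicHalfSpace S) ∧
    X = H3 ∩ ⋂₀ 𝓗
  convex : Convex ℝ X
  compact : IsCompact X
  interior_nonempty : (interior X).Nonempty

/-- The (non-empty, proper) faces of a convex polyhedron: its `2`-dimensional faces, its edges and
its vertices. -/
def IsProperFace (X F : Set E3) : Prop := IsExposed ℝ X F ∧ F.Nonempty ∧ F ≠ X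

/-- The dimension of the affine span of a set. -/
def dimension (F : Set E3) : ℕ := Module.finrank ℝ (vectorSpan ℝ F)

/-- The boundary decomposition of the polyhedron `X` into its faces is dual to the triangulation
`T`, the face dual to the simplex `s` being `cell s`: this is a bijection between the simplices of
`T` and the faces of `X`, it reverses inclusion, and vertices, edges, triangles of `T` correspond
to faces of dimension `2`, `1`, `0`. -/
structure IsDualDecomposition {V : Type*} (T : AbstractSimplicialComplex V) (X : Set E3)
    (cell : Finset V → Set E3) : Prop where
  bijOn : Set.BijOn cell T.faces {F | IsProperFace X F}
  subset_iff : ∀ s ∈ T.faces, ∀ t ∈ T.faces, (s ⊆ t ↔ cell t ⊆ cell s)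
  dimension_add : ∀ s ∈ T.faces, dimension (cell s) + s.card = 3
  frontier_eq : frontier X = ⋃ v : V, cell {v}

/-- The hyperbolic Riemannian metric of the Klein model at the point `p` of the open unit ball. -/
def kleinInner (p u v : E3) : ℝ :=
  inner ℝ u v / (1 - ‖p‖ ^ 2) + inner ℝ p u * inner ℝ p v / (1 - ‖p‖ ^ 2) ^ 2

/-- The hyperbolic angle of two non-zero tangent vectors at `p`. -/
def kleinAngle (p u v : E3) : ℝ :=
  Real.arccos (kleinInner p u v / (√(kleinInner p u u) * √(kleinInner p v v)))

/-- The non-zero tangent vectors at the point `p` of the edge `e` of the face `F` which are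
orthogonal to `e` and point into `F`. -/
def inwardNormals (F e : Set E3) (p : E3) : Set E3 :=
  {a | a ≠ 0 ∧ (∀ x ∈ e, kleinInner p a (x - p) = 0) ∧ ∃ ε : ℝ, 0 < ε ∧ p + ε • a ∈ F}

/-- The `2`-dimensional faces `F` and `G` of a convex polyhedron meet along their common edge
`F ∩ G` in the dihedral angle `θ`: at each relatively interior point of the edge, the directions
orthogonal to the edge and pointing into `F` and into `G` make the angle `θ`. -/
def HasDihedralAngle (F G : Set E3) (θ : ℝ) : Prop :=
  ∀ p ∈ intrinsicInterior ℝ (F ∩ G),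
    (inwardNormals F (F ∩ G) p).Nonempty ∧ (inwardNormals G (F ∩ G) p).Nonempty ∧
    ∀ a ∈ inwardNormals F (F ∩ G) p, ∀ b ∈ inwardNormals G (F ∩ G) p, kleinAngle p a b = θ

end

end CirclePattern

/-!
A disk with centre `z` and radius `r` bounds the Euclidean half-space `⟪z, x⟫ ≤ cos r`, so that `Q`
is the part in the unit ball of a Euclidean polyhedron. The proof finds the vertices of this
polyhedron first, one for every triangle of `T`, and then reads off everything else from them.

*The vertices.* By `(c2)` the overlap angles along a triangle are the angles of a spherical
triangle, so the Gram matrix of the Lorentzian normals of the three planes is positive definite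
(`gram_det_pos`, `eq_zero_of_norm_le`). Hence the three planes meet in one point of hyperbolic space
(`ConditionC2.exists_vertex`). This point lies strictly inside the half-space of every other disk
(`inner_lt_of_notMem`): otherwise the disk of some further vertex `x` meets each pairwise
intersection of the disks of the triangle, in an end of a geodesic through the point. Then `x` is
joined to the three vertices of the triangle, and by `(cr)` none of the three new `3`-cycles
separates. A non-separating `3`-cycle bounds a triangle
(`IsSphereTriangulation.mem_faces_of_not_separating`, a Jordan curve theorem that comes from the
vanishing of the first homology modulo `2`, which in turn is Euler's formula), so `T` is the boundary
of a tetrahedron, which has only four vertices.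

*The polyhedron.* At the vertex of a triangle `t`, precisely three independent inequalities are
equalities, and the three edges there lead to the vertices of the triangles adjacent to `t`. These
edges span a cone that contains the polyhedron, so a linear functional that is maximal among the
vertices is maximal on the polyhedron (`IsDualVertices.le_of_vertices`). Thus the polyhedron is the
convex hull of the vertices; in particular it is compact and lies in the open ball. Its faces are
the cells dual to the simplices of `T`, because each cell has a point that lies on no further
bounding plane (`IsDualVertices.isDualDecomposition`).

*The angles.* At a point of an edge, the inward normals of the two adjacent faces are combinations
of the hyperbolic gradients of the two linear functions `⟪z, ·⟫`, whose products are those of the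
Lorentzian normals (`mem_inwardNormals_iff`, `kleinAngle_inwardDirection`).
-/

namespace CirclePattern

/-! ### Combinatorics of sphere triangulations -/

section Combinatorics

variable {V : Type*} {T : AbstractSimplicialComplex V}

/-- The edges of a complex, as two-element vertex sets. -/
def edges (T : AbstractSimplicialComplex V) : Set (Finset V) := {e | e ∈ T.faces ∧ e.card = 2}

/-- The triangles of a complex, as three-element vertex sets. -/
def triangles (T : AbstractSimplicialComplex V) : Set (Finset V) := {t | t ∈ T.faces ∧ t.card = 3}

theorem mem_faces_of_subset {s t : Finset V} (ht : t ∈ T.faces) (hst : s ⊆ t) (hs : s.Nonempty) :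
    s ∈ T.faces :=
  (T.isRelLowerSet_faces ht).2 hst hs

variable [DecidableEq V]

theorem pair_mem_edges {a b : V} (h : (oneSkeleton T).Adj a b) : ({a, b} : Finset V) ∈ edges T :=
  ⟨h.2, Finset.card_pair h.1⟩

theorem adj_of_mem_face {a b : V} {s : Finset V} (hs : s ∈ T.faces) (ha : a ∈ s) (hb : b ∈ s)
    (hab : a ≠ b) : (oneSkeleton T).Adj a b := by
  refine ⟨hab, mem_faces_of_subset hs ?_ (by simp)⟩
  intro x hx
  simp only [Finset.mem_insert, Finset.mem_singleton] at hx
  rcases hx with rfl | rfl <;> assumption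

theorem eq_insert_of_subset {s t : Finset V} {v : V} (hst : s ⊆ t) (hv : v ∈ t) (hvs : v ∉ s)
    (h : t.card ≤ s.card + 1) : t = insert v s :=
  (Finset.eq_of_subset_of_card_le (Finset.insert_subset hv hst)
    (by rw [Finset.card_insert_of_notMem hvs]; exact h)).symm

variable [Fintype V]

theorem IsSphereTriangulation.exists_two_triangles (hT : IsSphereTriangulation T) {e : Finset V}
    (he : e ∈ edges T) :
    ∃ t t', t ≠ t' ∧ ∀ s, (s ∈ triangles T ∧ e ⊆ s) ↔ s = t ∨ s = t' := by
  obtain ⟨t, t', hne, h⟩ := Set.ncard_eq_two.mp (hT.edge_two e he.1 he.2)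
  refine ⟨t, t', hne, fun s => ?_⟩
  have := Set.ext_iff.mp h s
  rw [triangles, Set.mem_ofPred_eq, and_assoc]
  exact this

/-- The triangle across the side of `t` opposite to the vertex `v`. -/
theorem IsSphereTriangulation.exists_opposite (hT : IsSphereTriangulation T) {t : Finset V}
    (ht : t ∈ triangles T) {v : V} (hv : v ∈ t) :
    ∃ t' ∈ triangles T, t.erase v ⊆ t' ∧ v ∉ t' := by
  have hc : (t.erase v).card = 2 := by rw [Finset.card_erase_of_mem hv, ht.2]
  have he : t.erase v ∈ edges T :=
    ⟨mem_faces_of_subset ht.1 (Finset.erase_subset _ _) (Finset.card_pos.mp (by omega)), hc⟩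
  obtain ⟨t₁, t₂, hne, h⟩ := hT.exists_two_triangles he
  by_contra! hcon
  obtain ⟨h₁, h₁'⟩ := (h t₁).mpr (Or.inl rfl)
  obtain ⟨h₂, h₂'⟩ := (h t₂).mpr (Or.inr rfl)
  apply hne
  rw [eq_insert_of_subset h₁' (hcon _ h₁ h₁') (by simp) (by rw [hc, h₁.2]),
    eq_insert_of_subset h₂' (hcon _ h₂ h₂') (by simp) (by rw [hc, h₂.2])]

/-- A simplex is the intersection of the triangles containing it. -/
theorem IsSphereTriangulation.exists_triangle_notMem (hT : IsSphereTriangulation T) {s : Finset V}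
    (hs : s ∈ T.faces) {v : V} (hv : v ∉ s) : ∃ t ∈ triangles T, s ⊆ t ∧ v ∉ t := by
  obtain ⟨t, ht, hst, hc⟩ := hT.pure s hs
  by_cases hvt : v ∈ t
  · obtain ⟨t', ht', h, h'⟩ := hT.exists_opposite ⟨ht, hc⟩ hvt
    exact ⟨t', ht', (Finset.subset_erase.mpr ⟨hst, hv⟩).trans h, h'⟩
  · exact ⟨t, ⟨ht, hc⟩, hst, hvt⟩

theorem IsSphereTriangulation.exists_triangle_mem (hT : IsSphereTriangulation T) (v : V) :
    ∃ t ∈ triangles T, v ∈ t := by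
  obtain ⟨t, ht, hst, hc⟩ := hT.pure {v} (T.singleton_mem v)
  exact ⟨t, ⟨ht, hc⟩, hst (by simp)⟩

/-- A function of the triangles that does not change across the edges at `v` is constant on the
star of `v`, because the link of `v` is connected. -/
theorem IsSphereTriangulation.constant_on_star (hT : IsSphereTriangulation T) {α : Type*}
    (f : Finset V → α) (v : V)
    (hf : ∀ e ∈ edges T, v ∈ e → ∀ t ∈ triangles T, ∀ t' ∈ triangles T, e ⊆ t → e ⊆ t' →
      f t = f t') :
    ∀ t ∈ triangles T, ∀ t' ∈ triangles T, v ∈ t → v ∈ t' → f t = f t' := by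
  have key : ∀ (a b : {w : V // (oneSkeleton T).Adj v w}), (link T v).Walk a b →
      ∀ t ∈ triangles T, ∀ t' ∈ triangles T, ({v, a.1} : Finset V) ⊆ t →
        ({v, b.1} : Finset V) ⊆ t' → f t = f t' := by
    intro a b w
    induction w with
    | nil =>
      intro t ht t' ht' h h'
      exact hf _ (pair_mem_edges (Subtype.prop _)) (by simp) t ht t' ht' h h'
    | @cons a c b hac _ ih =>
      intro t ht t' ht' h h'
      have hm : ({v, a.1, c.1} : Finset V) ∈ triangles T := by
        refine ⟨hac.2, Finset.card_eq_three.mpr ⟨v, a.1, c.1, a.2.1, c.2.1, ?_, rfl⟩⟩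
        exact fun h => hac.1 (Subtype.ext h)
      have h₁ : ({v, a.1} : Finset V) ⊆ {v, a.1, c.1} := by
        intro x; simp; tauto
      have h₂ : ({v, c.1} : Finset V) ⊆ {v, a.1, c.1} := by
        intro x; simp; tauto
      exact (hf _ (pair_mem_edges a.2) (by simp) t ht _ hm h h₁).trans (ih _ hm t' ht' h₂ h')
  have nb : ∀ t ∈ triangles T, v ∈ t → ∃ a : {w : V // (oneSkeleton T).Adj v w},
      ({v, a.1} : Finset V) ⊆ t := by
    intro t ht hv
    obtain ⟨a, ha⟩ : (t.erase v).Nonempty :=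
      Finset.card_pos.mp (by rw [Finset.card_erase_of_mem hv, ht.2]; norm_num)
    rw [Finset.mem_erase] at ha
    refine ⟨⟨a, adj_of_mem_face ht.1 hv ha.2 ha.1.symm⟩, ?_⟩
    intro x hx
    simp only [Finset.mem_insert, Finset.mem_singleton] at hx
    rcases hx with rfl | rfl
    exacts [hv, ha.2]
  intro t ht t' ht' h h'
  obtain ⟨a, ha⟩ := nb t ht h
  obtain ⟨b, hb⟩ := nb t' ht' h'
  obtain ⟨w⟩ := (hT.link_connected v).preconnected a b
  exact key a b w t ht t' ht' ha hb

/-- A function of the triangles that does not change across edges is constant. -/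
theorem IsSphereTriangulation.constant_of_edges (hT : IsSphereTriangulation T) {α : Type*}
    (f : Finset V → α)
    (hf : ∀ e ∈ edges T, ∀ t ∈ triangles T, ∀ t' ∈ triangles T, e ⊆ t → e ⊆ t' → f t = f t') :
    ∀ t ∈ triangles T, ∀ t' ∈ triangles T, f t = f t' := by
  have key : ∀ a b : V, (oneSkeleton T).Walk a b →
      ∀ t ∈ triangles T, ∀ t' ∈ triangles T, a ∈ t → b ∈ t' → f t = f t' := by
    intro a b w
    induction w with
    | nil =>
      intro t ht t' ht' h h'
      exact hT.constant_on_star f _ (fun e he _ => hf e he) t ht t' ht' h h'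
    | @cons a c b hac _ ih =>
      intro t ht t' ht' h h'
      obtain ⟨s, hs, hst, hc⟩ := hT.pure _ hac.2
      exact (hT.constant_on_star f a (fun e he _ => hf e he) t ht s ⟨hs, hc⟩ h
        (hst (by simp))).trans (ih s ⟨hs, hc⟩ t' ht' (hst (by simp)) h')
  intro t ht t' ht'
  obtain ⟨a, ha⟩ := Finset.card_pos.mp (by rw [ht.2]; norm_num : 0 < t.card)
  obtain ⟨b, hb⟩ := Finset.card_pos.mp (by rw [ht'.2]; norm_num : 0 < t'.card)
  obtain ⟨w⟩ := hT.connected.preconnected a b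
  exact key a b w t ht t' ht' ha hb

/-- A sphere triangulation containing the boundary of a tetrahedron is that boundary. -/
theorem IsSphereTriangulation.card_le_of_tetrahedron (hT : IsSphereTriangulation T) {S : Finset V}
    (hS : S.card = 4) (hf : ∀ t ⊆ S, t.card = 3 → t ∈ T.faces) : Fintype.card V ≤ 4 := by
  have hconst : ∀ t ∈ triangles T, ∀ t' ∈ triangles T, (t ⊆ S) = (t' ⊆ S) := by
    refine hT.constant_of_edges (fun t => t ⊆ S) fun e he => ?_
    have main : ∀ t ∈ triangles T, ∀ t' ∈ triangles T, e ⊆ t → e ⊆ t' → t ⊆ S → t' ⊆ S := by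
      intro t ht t' ht' h h' htS
      obtain ⟨y, hy⟩ : (t \ e).Nonempty := Finset.card_pos.mp (by
        rw [Finset.card_sdiff_of_subset h, ht.2, he.2]; norm_num)
      rw [Finset.mem_sdiff] at hy
      have hyS : y ∈ S := htS hy.1
      -- the two triangles of `S` at the edge `e` are `t` and `S.erase y`
      have ht₂ : S.erase y ∈ triangles T := by
        have hc : (S.erase y).card = 3 := by rw [Finset.card_erase_of_mem hyS, hS]
        exact ⟨hf _ (Finset.erase_subset _ _) hc, hc⟩
      have he₂ : e ⊆ S.erase y := Finset.subset_erase.mpr ⟨h.trans htS, hy.2⟩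
      have hne : t ≠ S.erase y := fun hh => by
        have := hy.1; rw [hh] at this; simp at this
      obtain ⟨a, b, hab, hiff⟩ := hT.exists_two_triangles he
      have e₁ := (hiff t).mp ⟨ht, h⟩
      have e₂ := (hiff _).mp ⟨ht₂, he₂⟩
      have e₃ := (hiff t').mp ⟨ht', h'⟩
      have : t' = t ∨ t' = S.erase y := by
        rcases e₁ with rfl | rfl <;> rcases e₂ with e₂ | e₂ <;> rcases e₃ with rfl | rfl <;>
          simp_all
      rcases this with rfl | rfl
      exacts [htS, Finset.erase_subset _ _]
    intro t ht t' ht' h h'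
    exact propext ⟨main t ht t' ht' h h', main t' ht' t ht h' h⟩
  obtain ⟨t₀, ht₀, hc₀⟩ := Finset.exists_subset_card_eq (show 3 ≤ S.card by omega)
  have h₀ : t₀ ∈ triangles T := ⟨hf _ ht₀ hc₀, hc₀⟩
  have : (Finset.univ : Finset V) ⊆ S := by
    intro v _
    obtain ⟨t, ht, hv⟩ := hT.exists_triangle_mem v
    exact ((hconst t₀ h₀ t ht).mp ht₀) hv
  rw [← hS]
  exact Finset.card_le_card this

/-! ### Homology modulo 2 and the Jordan curve theorem -/

noncomputable instance : Fintype (edges T) := Fintype.ofFinite _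

noncomputable instance : Fintype (triangles T) := Fintype.ofFinite _

/-- The boundary operator from edges to vertices, modulo `2`. -/
def edgeBoundary (T : AbstractSimplicialComplex V) : Matrix V (edges T) (ZMod 2) :=
  Matrix.of fun v e => if v ∈ e.1 then 1 else 0

/-- The boundary operator from triangles to edges, modulo `2`. -/
def triangleBoundary (T : AbstractSimplicialComplex V) :
    Matrix (edges T) (triangles T) (ZMod 2) :=
  Matrix.of fun e t => if e.1 ⊆ t.1 then 1 else 0

/-- The three sides of a triangle, whether or not it is a face, form a cycle modulo `2`. -/
theorem edgeBoundary_mulVec_sides {t : Finset V} (ht : t.card = 3)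
    (hf : ∀ e ⊆ t, e.card = 2 → e ∈ T.faces) :
    (edgeBoundary T).mulVec (fun e => if e.1 ⊆ t then 1 else 0) = 0 := by
  funext v
  simp only [Matrix.mulVec, dotProduct, edgeBoundary, Matrix.of_apply, Pi.zero_apply, mul_ite,
    mul_one, mul_zero, ← ite_and]
  rw [Finset.sum_boole]
  by_cases hv : v ∈ t
  · obtain ⟨a, b, hab, htab⟩ := Finset.card_eq_two.mp
      (show (t.erase v).card = 2 by rw [Finset.card_erase_of_mem hv, ht])
    have hteq : t = {v, a, b} := by rw [← Finset.insert_erase hv, htab]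
    have hva : v ≠ a := fun h => by
      have : a ∈ t.erase v := by rw [htab]; simp
      exact (Finset.ne_of_mem_erase this) h.symm
    have hvb : v ≠ b := fun h => by
      have : b ∈ t.erase v := by rw [htab]; simp
      exact (Finset.ne_of_mem_erase this) h.symm
    have h₁ : ({v, a} : Finset V) ∈ edges T :=
      ⟨hf _ (by rw [hteq]; intro x; simp; tauto) (Finset.card_pair hva), Finset.card_pair hva⟩
    have h₂ : ({v, b} : Finset V) ∈ edges T :=
      ⟨hf _ (by rw [hteq]; intro x; simp; tauto) (Finset.card_pair hvb), Finset.card_pair hvb⟩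
    have : (Finset.univ.filter fun e : edges T => e.1 ⊆ t ∧ v ∈ e.1) =
        {⟨_, h₁⟩, ⟨_, h₂⟩} := by
      ext ⟨e, he⟩
      simp only [Finset.mem_filter, Finset.mem_univ, true_and, Finset.mem_insert,
        Finset.mem_singleton, Subtype.mk.injEq]
      constructor
      · rintro ⟨hs, hve⟩
        obtain ⟨x, hx⟩ := Finset.card_eq_one.mp
          (show (e.erase v).card = 1 by rw [Finset.card_erase_of_mem hve, he.2])
        have hxe : x ∈ e.erase v := by rw [hx]; simp
        have hxt : x ∈ t.erase v := Finset.erase_subset_erase v hs hxe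
        rw [htab] at hxt
        simp only [Finset.mem_insert, Finset.mem_singleton] at hxt
        rw [← Finset.insert_erase hve, hx]
        rcases hxt with rfl | rfl <;> simp
      · rw [hteq]
        rintro (rfl | rfl)
        · exact ⟨by intro x; simp; tauto, by simp⟩
        · exact ⟨by intro x; simp; tauto, by simp⟩
    rw [this, Finset.card_pair]
    · decide
    · intro h
      rw [Subtype.mk.injEq] at h
      have : a ∈ ({v, b} : Finset V) := by rw [← h]; simp
      simp only [Finset.mem_insert, Finset.mem_singleton] at this
      rcases this with h | h
      exacts [hva h.symm, hab h]
  · rw [Finset.filter_false_of_mem]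
    · simp
    · rintro e - h
      exact hv (h.1 h.2)

theorem edgeBoundary_mul_triangleBoundary : edgeBoundary T * triangleBoundary T = 0 := by
  ext v t
  have := congrFun (edgeBoundary_mulVec_sides (T := T) t.2.2
    (fun e he hc => mem_faces_of_subset t.2.1 he (Finset.card_pos.mp (by omega)))) v
  simpa [Matrix.mul_apply, Matrix.mulVec, dotProduct, triangleBoundary] using this

/-- The kernel of the transpose of the boundary operator consists of the functions that are constant
along edges, and the `1`-skeleton is connected. -/
theorem IsSphereTriangulation.card_le_rank_edgeBoundary (hT : IsSphereTriangulation T) :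
    Fintype.card V ≤ (edgeBoundary T).rank + 1 := by
  have h := LinearMap.finrank_range_add_finrank_ker (edgeBoundary T).transpose.mulVecLin
  have hk : Module.finrank (ZMod 2) (LinearMap.ker (edgeBoundary T).transpose.mulVecLin) ≤ 1 := by
    have hconst : ∀ g : V → ZMod 2, (edgeBoundary T).transpose.mulVec g = 0 → ∀ a b, g a = g b := by
      intro g hg a b
      obtain ⟨w⟩ := hT.connected.preconnected a b
      induction w with
      | nil => rfl
      | @cons a c b hac _ ih =>
        rw [← ih]
        have := congrFun hg ⟨_, pair_mem_edges hac⟩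
        simp only [Matrix.mulVec, dotProduct, edgeBoundary, Matrix.transpose_apply, Matrix.of_apply,
          ite_mul, one_mul, zero_mul, Pi.zero_apply, Finset.sum_ite_mem, Finset.univ_inter] at this
        rw [Finset.sum_pair hac.1] at this
        exact CharTwo.add_eq_zero.mp this
    have hone : (edgeBoundary T).transpose.mulVec (fun _ => 1) = 0 := by
      funext e
      simp only [Matrix.mulVec, dotProduct, edgeBoundary, Matrix.transpose_apply, Matrix.of_apply,
          ite_mul, one_mul, zero_mul, Pi.zero_apply, Finset.sum_ite_mem, Finset.univ_inter]
      rw [Finset.sum_const, e.2.2]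
      decide
    obtain ⟨v₀⟩ := hT.connected.nonempty
    refine finrank_le_one ⟨fun _ => 1, LinearMap.mem_ker.mpr hone⟩ fun g => ⟨g.1 v₀, ?_⟩
    ext v
    simpa using hconst g.1 (LinearMap.mem_ker.mp g.2) v₀ v
  have hr : Module.finrank (ZMod 2) (LinearMap.range (edgeBoundary T).transpose.mulVecLin) =
      (edgeBoundary T).rank := by
    rw [← Matrix.rank_transpose]; rfl
  rw [Module.finrank_fintype_fun_eq_card, hr] at h
  omega

theorem IsSphereTriangulation.triangleBoundary_mulVec (hT : IsSphereTriangulation T)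
    (f : triangles T → ZMod 2) (e : edges T) {t t' : triangles T} (hne : t ≠ t')
    (ht : e.1 ⊆ t.1) (ht' : e.1 ⊆ t'.1) :
    (triangleBoundary T).mulVec f e = f t + f t' := by
  simp only [Matrix.mulVec, dotProduct, triangleBoundary, Matrix.of_apply, ite_mul, one_mul,
    zero_mul]
  rw [← Finset.sum_filter, ← Finset.sum_pair hne]
  congr 1
  obtain ⟨a, b, hab, hiff⟩ := hT.exists_two_triangles e.2
  have h₁ := (hiff t).mp ⟨t.2, ht⟩
  have h₂ := (hiff t').mp ⟨t'.2, ht'⟩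
  ext s
  have h₃ := hiff s
  have h₄ := s.2
  have h₅ : t.1 ≠ t'.1 := fun h => hne (Subtype.ext h)
  simp only [Finset.mem_filter, Finset.mem_univ, true_and, Finset.mem_insert,
    Finset.mem_singleton, Subtype.ext_iff]
  grind

/-- A chain of triangles takes equal values on the two triangles of an edge that is not in its
boundary. -/
theorem IsSphereTriangulation.eq_of_boundary_eq_zero (hT : IsSphereTriangulation T)
    (f : triangles T → ZMod 2) (e : edges T) (he : (triangleBoundary T).mulVec f e = 0)
    {t t' : triangles T} (ht : e.1 ⊆ t.1) (ht' : e.1 ⊆ t'.1) : f t = f t' := by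
  by_cases h : t = t'
  · rw [h]
  · rw [hT.triangleBoundary_mulVec f e h ht ht'] at he
    exact CharTwo.add_eq_zero.mp he

open Classical in
/-- A cycle of triangles is constant, because triangles are connected through edges. -/
theorem IsSphereTriangulation.card_le_rank_triangleBoundary (hT : IsSphereTriangulation T) :
    Fintype.card (triangles T) ≤ (triangleBoundary T).rank + 1 := by
  have h := LinearMap.finrank_range_add_finrank_ker (triangleBoundary T).mulVecLin
  have hk : Module.finrank (ZMod 2) (LinearMap.ker (triangleBoundary T).mulVecLin) ≤ 1 := by
    have hconst : ∀ g : triangles T → ZMod 2, (triangleBoundary T).mulVec g = 0 →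
        ∀ a b, g a = g b := by
      intro g hg a b
      have := hT.constant_of_edges (fun t => if h : t ∈ triangles T then g ⟨t, h⟩ else 0)
        (fun e he t ht t' ht' h h' => by
          rw [dif_pos ht, dif_pos ht']
          exact hT.eq_of_boundary_eq_zero g ⟨e, he⟩ (congrFun hg _) h h')
        a.1 a.2 b.1 b.2
      simpa using this
    have hone : (triangleBoundary T).mulVec (fun _ => 1) = 0 := by
      funext e
      obtain ⟨a, b, hab, hiff⟩ := hT.exists_two_triangles e.2
      have ha := (hiff a).mpr (Or.inl rfl)
      have hb := (hiff b).mpr (Or.inr rfl)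
      rw [hT.triangleBoundary_mulVec _ e (t := ⟨a, ha.1⟩) (t' := ⟨b, hb.1⟩)
        (fun h => hab (congrArg Subtype.val h)) ha.2 hb.2]
      exact CharTwo.add_self_eq_zero _
    obtain ⟨v₀⟩ := hT.connected.nonempty
    obtain ⟨t₀, ht₀, -⟩ := hT.exists_triangle_mem v₀
    refine finrank_le_one ⟨fun _ => 1, LinearMap.mem_ker.mpr hone⟩ fun g => ⟨g.1 ⟨t₀, ht₀⟩, ?_⟩
    ext t
    simpa using hconst g.1 (LinearMap.mem_ker.mp g.2) ⟨t₀, ht₀⟩ t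
  have hr : Module.finrank (ZMod 2) (LinearMap.range (triangleBoundary T).mulVecLin) =
      (triangleBoundary T).rank := rfl
  rw [Module.finrank_fintype_fun_eq_card, hr] at h
  omega

theorem IsSphereTriangulation.euler_card (hT : IsSphereTriangulation T) :
    Fintype.card V + Fintype.card (triangles T) = Fintype.card (edges T) + 2 := by
  have h := hT.euler
  have h₁ : {s | s ∈ T.faces ∧ s.card = 1} = Set.range (fun v : V => ({v} : Finset V)) := by
    ext s
    simp only [Set.mem_ofPred_eq, Set.mem_range]
    constructor
    · rintro ⟨-, hs⟩
      obtain ⟨v, rfl⟩ := Finset.card_eq_one.mp hs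
      exact ⟨v, rfl⟩
    · rintro ⟨v, rfl⟩
      exact ⟨T.singleton_mem v, by simp⟩
  rw [h₁, Set.ncard_range_of_injective (Finset.singleton_injective), Nat.card_eq_fintype_card] at h
  rwa [← Nat.card_eq_fintype_card, ← Nat.card_eq_fintype_card, ← Nat.card_eq_fintype_card,
    Nat.card_coe_set_eq, Nat.card_coe_set_eq, Nat.card_eq_fintype_card]

/-- The first homology of the sphere modulo `2` vanishes: by Euler's formula, the boundaries and the
cycles have the same dimension. -/
theorem IsSphereTriangulation.exists_triangleBoundary_eq (hT : IsSphereTriangulation T)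
    {g : edges T → ZMod 2} (hg : (edgeBoundary T).mulVec g = 0) :
    ∃ f, (triangleBoundary T).mulVec f = g := by
  have hle : LinearMap.range (triangleBoundary T).mulVecLin ≤
      LinearMap.ker (edgeBoundary T).mulVecLin := by
    rintro _ ⟨f, rfl⟩
    simp [Matrix.mulVec_mulVec, edgeBoundary_mul_triangleBoundary]
  have h := LinearMap.finrank_range_add_finrank_ker (edgeBoundary T).mulVecLin
  have hr : Module.finrank (ZMod 2) (LinearMap.range (edgeBoundary T).mulVecLin) =
      (edgeBoundary T).rank := rfl
  have hr' : Module.finrank (ZMod 2) (LinearMap.range (triangleBoundary T).mulVecLin) =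
      (triangleBoundary T).rank := rfl
  rw [Module.finrank_fintype_fun_eq_card, hr] at h
  have h₁ := hT.card_le_rank_edgeBoundary
  have h₂ := hT.card_le_rank_triangleBoundary
  have h₃ := hT.euler_card
  have heq := Submodule.eq_of_le_of_finrank_le hle (by rw [hr']; omega)
  have : g ∈ LinearMap.range (triangleBoundary T).mulVecLin := by
    rw [heq]; exact LinearMap.mem_ker.mpr hg
  exact this

open Classical in
/-- A discrete Jordan curve theorem: a `3`-cycle whose complement is connected bounds a triangle.
A chain of triangles bounded by the cycle is constant on the triangles with a vertex off the cycle.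
If the cycle is not a face, these are all the triangles, and a constant chain has no boundary. -/
theorem IsSphereTriangulation.mem_faces_of_not_separating (hT : IsSphereTriangulation T) {a b c : V}
    (hab : (oneSkeleton T).Adj a b) (hbc : (oneSkeleton T).Adj b c) (hca : (oneSkeleton T).Adj c a)
    (hsep : ¬ IsSeparatingThreeCycle T a b c) : ({a, b, c} : Finset V) ∈ T.faces := by
  by_contra hface
  have hconn : ((oneSkeleton T).induce ({a, b, c} : Set V)ᶜ).Preconnected := by
    by_contra h
    exact hsep ⟨hab, hbc, hca, h⟩
  set S : Finset V := {a, b, c} with hS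
  have hScard : S.card = 3 := Finset.card_eq_three.mpr ⟨a, b, c, hab.1, hca.1.symm, hbc.1, rfl⟩
  have hpairs : ∀ e ⊆ S, e.card = 2 → e ∈ T.faces := by
    intro e he hc
    obtain ⟨x, y, hxy, rfl⟩ := Finset.card_eq_two.mp hc
    have hx : x ∈ S := he (by simp)
    have hy : y ∈ S := he (by simp)
    have hadj : (oneSkeleton T).Adj x y := by
      simp only [hS, Finset.mem_insert, Finset.mem_singleton] at hx hy
      rcases hx with rfl | rfl | rfl <;> rcases hy with rfl | rfl | rfl <;>
        first | exact absurd rfl hxy | assumption | (apply SimpleGraph.Adj.symm; assumption)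
    exact hadj.2
  obtain ⟨f, hf⟩ := hT.exists_triangleBoundary_eq (edgeBoundary_mulVec_sides hScard hpairs)
  set F : Finset V → ZMod 2 := fun t => if h : t ∈ triangles T then f ⟨t, h⟩ else 0 with hF
  have hFf : ∀ t : triangles T, F t.1 = f t := fun t => by simp [hF]
  have hstar : ∀ v ∉ S, ∀ t ∈ triangles T, ∀ t' ∈ triangles T, v ∈ t → v ∈ t' → F t = F t' := by
    intro v hv
    refine hT.constant_on_star F v fun e he hve t ht t' ht' h h' => ?_
    rw [hFf ⟨t, ht⟩, hFf ⟨t', ht'⟩]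
    refine hT.eq_of_boundary_eq_zero f ⟨e, he⟩ ?_ h h'
    rw [hf]
    exact if_neg fun hsub => hv (hsub hve)
  have hmem : ∀ x : (({a, b, c} : Set V)ᶜ : Set V), x.1 ∉ S := fun x hx =>
    x.2 (by simpa [hS] using hx)
  have hwalk : ∀ x y : (({a, b, c} : Set V)ᶜ : Set V),
      ((oneSkeleton T).induce ({a, b, c} : Set V)ᶜ).Walk x y →
      ∀ t ∈ triangles T, ∀ t' ∈ triangles T, x.1 ∈ t → y.1 ∈ t' → F t = F t' := by
    intro x y w
    induction w with
    | @nil x => exact hstar x.1 (hmem x)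
    | @cons x z y hxz _ ih =>
      intro t ht t' ht' h h'
      obtain ⟨s, hs, hst, hc⟩ := hT.pure _ (SimpleGraph.comap_adj.mp hxz).2
      exact (hstar x.1 (hmem x) t ht s ⟨hs, hc⟩ h (hst (by simp))).trans
        (ih s ⟨hs, hc⟩ t' ht' (hst (by simp)) h')
  have hoff : ∀ t ∈ triangles T, ∃ v ∈ t, v ∉ S := by
    intro t ht
    by_contra! hcon
    have : t = S := Finset.eq_of_subset_of_card_le hcon (by rw [hScard, ht.2])
    exact hface (this ▸ ht.1)
  have hall : ∀ t ∈ triangles T, ∀ t' ∈ triangles T, F t = F t' := by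
    intro t ht t' ht'
    obtain ⟨x, hx, hxS⟩ := hoff t ht
    obtain ⟨y, hy, hyS⟩ := hoff t' ht'
    obtain ⟨w⟩ := hconn ⟨x, by simpa [hS] using hxS⟩ ⟨y, by simpa [hS] using hyS⟩
    exact hwalk _ _ w t ht t' ht' hx hy
  -- the boundary of a constant chain vanishes on the edge `[a, b]` of the cycle
  obtain ⟨t, t', hne, hiff⟩ := hT.exists_two_triangles (pair_mem_edges hab)
  obtain ⟨ht, hst⟩ := (hiff t).mpr (Or.inl rfl)
  obtain ⟨ht', hst'⟩ := (hiff t').mpr (Or.inr rfl)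
  have h₁ := hT.triangleBoundary_mulVec f ⟨_, pair_mem_edges hab⟩ (t := ⟨t, ht⟩)
    (t' := ⟨t', ht'⟩) (fun h => hne (congrArg Subtype.val h)) hst hst'
  have hsub : ({a, b} : Finset V) ⊆ S := by
    intro x; simp [hS]; tauto
  rw [hf, ← hFf, ← hFf, hall t ht t' ht', CharTwo.add_self_eq_zero] at h₁
  exact one_ne_zero ((if_pos hsub).symm.trans h₁)

end Combinatorics

/-! ### Simple polyhedra with prescribed vertices -/

section Polyhedron

open Filter Topology

/-- The closed convex set cut out by the inequalities `⟪z v, x⟫ ≤ c v`. -/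
def polyhedron {V : Type*} (z : V → E3) (c : V → ℝ) : Set E3 :=
  {x | ∀ v, inner ℝ (z v) x ≤ c v}

/-- The points of the polyhedron where the inequalities indexed by `s` are equalities. -/
def cell {V : Type*} (z : V → E3) (c : V → ℝ) (s : Finset V) : Set E3 :=
  {x | x ∈ polyhedron z c ∧ ∀ v ∈ s, inner ℝ (z v) x = c v}

/-- The subspace of the vectors orthogonal to all `z v`, `v ∈ s`. -/
noncomputable def normalSpace {V : Type*} (z : V → E3) (s : Finset V) : Submodule ℝ E3 :=
  (Submodule.span ℝ (Set.range fun v : s => z v))ᗮ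

variable {V : Type*} {z : V → E3} {c : V → ℝ}

theorem mem_normalSpace {s : Finset V} {y : E3} :
    y ∈ normalSpace z s ↔ ∀ v ∈ s, inner ℝ (z v) y = 0 := by
  rw [normalSpace, Submodule.mem_orthogonal]
  constructor
  · intro h v hv
    exact h _ (Submodule.subset_span ⟨⟨v, hv⟩, rfl⟩)
  · intro h u hu
    induction hu using Submodule.span_induction with
    | mem x hx => obtain ⟨v, rfl⟩ := hx; exact h v v.2
    | zero => simp
    | add x y _ _ hx hy => rw [inner_add_left, hx, hy, add_zero]
    | smul a x _ hx => rw [inner_smul_left, hx, mul_zero]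

theorem finrank_normalSpace {s : Finset V} (hs : LinearIndepOn ℝ z (s : Set V)) :
    Module.finrank ℝ (normalSpace z s) + s.card = 3 := by
  have h := (Submodule.span ℝ (Set.range fun v : s => z v)).finrank_add_finrank_orthogonal
  have h' : Module.finrank ℝ (Submodule.span ℝ (Set.range fun v : s => z v)) = s.card := by
    rw [finrank_span_eq_card (b := fun v : s => z v) hs]
    simp
  rw [h', finrank_euclideanSpace_fin] at h
  rw [normalSpace, add_comm]
  exact h

theorem convex_cell (s : Finset V) : Convex ℝ (cell z c s) := by
  intro x hx y hy a b ha hb hab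
  constructor
  · intro v
    rw [inner_add_right, inner_smul_right, inner_smul_right]
    calc a * inner ℝ (z v) x + b * inner ℝ (z v) y ≤ a * c v + b * c v :=
          add_le_add (mul_le_mul_of_nonneg_left (hx.1 v) ha) (mul_le_mul_of_nonneg_left (hy.1 v) hb)
      _ = c v := by rw [← add_mul, hab, one_mul]
  · intro v hv
    rw [inner_add_right, inner_smul_right, inner_smul_right, hx.2 v hv, hy.2 v hv, ← add_mul, hab,
      one_mul]

@[simp]
theorem cell_empty : cell z c ∅ = polyhedron z c := by
  ext x; simp [cell]

theorem isClosed_polyhedron : IsClosed (polyhedron z c) := by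
  have : polyhedron z c = ⋂ v, {x | inner ℝ (z v) x ≤ c v} := by
    ext x; simp [polyhedron]
  rw [this]
  exact isClosed_iInter fun v => isClosed_le (by fun_prop) continuous_const

variable {T : AbstractSimplicialComplex V} {p : Finset V → E3}

/-- The points `p t`, one for every triangle `t`, are simple vertices of the polyhedron: precisely
the three inequalities indexed by `t` are equalities at `p t`, and they are independent. -/
structure IsDualVertices (T : AbstractSimplicialComplex V) (z : V → E3) (c : V → ℝ)
    (p : Finset V → E3) : Prop where
  inner_eq : ∀ t ∈ triangles T, ∀ v ∈ t, inner ℝ (z v) (p t) = c v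
  inner_lt : ∀ t ∈ triangles T, ∀ v ∉ t, inner ℝ (z v) (p t) < c v
  linearIndepOn : ∀ t ∈ triangles T, LinearIndepOn ℝ z (t : Set V)

namespace IsDualVertices

theorem mem_cell (hp : IsDualVertices T z c p) {s t : Finset V} (ht : t ∈ triangles T)
    (hst : s ⊆ t) : p t ∈ cell z c s := by
  refine ⟨fun v => ?_, fun v hv => hp.inner_eq t ht v (hst hv)⟩
  by_cases hv : v ∈ t
  · exact (hp.inner_eq t ht v hv).le
  · exact (hp.inner_lt t ht v hv).le

theorem mem_polyhedron (hp : IsDualVertices T z c p) {t : Finset V} (ht : t ∈ triangles T) :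
    p t ∈ polyhedron z c := (hp.mem_cell ht (Finset.Subset.refl t)).1

theorem eq_zero (hp : IsDualVertices T z c p) {t : Finset V} (ht : t ∈ triangles T) {y : E3}
    (hy : ∀ v ∈ t, inner ℝ (z v) y = 0) : y = 0 := by
  have h := finrank_normalSpace (hp.linearIndepOn t ht)
  rw [ht.2] at h
  have h' : normalSpace z t = ⊥ := Submodule.finrank_eq_zero.mp (by omega)
  have : y ∈ normalSpace z t := mem_normalSpace.mpr hy
  rw [h'] at this
  exact (Submodule.mem_bot ℝ).mp this

end IsDualVertices

variable [Fintype V]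

/-- A convex subset of the polyhedron contains a point at which as few inequalities as possible are
equalities. -/
theorem exists_strict_point {C : Set E3} (hC : Convex ℝ C) (hne : C.Nonempty)
    (hsub : C ⊆ polyhedron z c) :
    ∃ x ∈ C, ∀ v, (∃ y ∈ C, inner ℝ (z v) y < c v) → inner ℝ (z v) x < c v := by
  classical
  obtain ⟨x₀, hx₀⟩ := hne
  rcases isEmpty_or_nonempty V with hV | hV
  · exact ⟨x₀, hx₀, fun v => hV.elim v⟩
  have : ∀ v, ∃ y ∈ C, (∃ y ∈ C, inner ℝ (z v) y < c v) → inner ℝ (z v) y < c v := by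
    intro v
    by_cases h : ∃ y ∈ C, inner ℝ (z v) y < c v
    · obtain ⟨y, hy, h'⟩ := h
      exact ⟨y, hy, fun _ => h'⟩
    · exact ⟨x₀, hx₀, fun h' => absurd h' h⟩
  choose y hyC hy using this
  have hN : (0 : ℝ) < Fintype.card V := by exact_mod_cast Fintype.card_pos
  have hsum : ∑ _v : V, (Fintype.card V : ℝ)⁻¹ = 1 := by
    rw [Finset.sum_const, Finset.card_univ, nsmul_eq_mul, mul_inv_cancel₀ hN.ne']
  refine ⟨∑ v, (Fintype.card V : ℝ)⁻¹ • y v,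
    hC.sum_mem (fun _ _ => (inv_pos.mpr hN).le) hsum fun v _ => hyC v, fun v hv => ?_⟩
  rw [inner_sum]
  simp_rw [inner_smul_right]
  calc ∑ u, (Fintype.card V : ℝ)⁻¹ * inner ℝ (z v) (y u)
      < ∑ _u : V, (Fintype.card V : ℝ)⁻¹ * c v :=
        Finset.sum_lt_sum
          (fun u _ => mul_le_mul_of_nonneg_left (hsub (hyC u) v) (inv_pos.mpr hN).le)
          ⟨v, Finset.mem_univ v, mul_lt_mul_of_pos_left (hy v hv) (inv_pos.mpr hN)⟩
    _ = c v := by rw [← Finset.sum_mul, hsum, one_mul]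

/-- One can move from a point of the polyhedron in every direction that does not violate the
inequalities which are equalities at that point. -/
theorem eventually_mem_polyhedron {s : Finset V} {x y : E3} (hx : x ∈ polyhedron z c)
    (hs : ∀ v ∉ s, inner ℝ (z v) x < c v) (hy : ∀ v ∈ s, inner ℝ (z v) y ≤ 0) :
    ∀ᶠ ε in 𝓝[>] (0 : ℝ), x + ε • y ∈ polyhedron z c := by
  refine eventually_all.mpr fun v => ?_
  by_cases hv : v ∈ s
  · filter_upwards [self_mem_nhdsWithin] with ε (hε : 0 < ε)
    rw [inner_add_right, inner_smul_right]
    nlinarith [hx v, mul_nonneg hε.le (neg_nonneg.mpr (hy v hv))]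
  · have : Continuous fun ε : ℝ => inner ℝ (z v) (x + ε • y) := by fun_prop
    have h := (this.tendsto 0).eventually_lt_const (u := c v) (by simpa using hs v hv)
    exact (h.filter_mono nhdsWithin_le_nhds).mono fun ε hε => hε.le

theorem exists_mem_polyhedron {s : Finset V} {x y : E3} (hx : x ∈ polyhedron z c)
    (hs : ∀ v ∉ s, inner ℝ (z v) x < c v) (hy : ∀ v ∈ s, inner ℝ (z v) y ≤ 0) :
    ∃ ε : ℝ, 0 < ε ∧ x + ε • y ∈ polyhedron z c := by
  obtain ⟨ε, h, hε⟩ := ((eventually_mem_polyhedron hx hs hy).and self_mem_nhdsWithin).exists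
  exact ⟨ε, hε, h⟩

/-- If `x` lies on the boundary of precisely the half-spaces indexed by `s`, then a linear
functional which is maximal at `x` takes the same value on the whole cell of `s`. -/
theorem le_of_isMax {s : Finset V} {x y : E3} (hx : x ∈ cell z c s)
    (hs : ∀ v ∉ s, inner ℝ (z v) x < c v) (f : StrongDual ℝ E3)
    (hf : ∀ w ∈ polyhedron z c, f w ≤ f x) (hy : y ∈ cell z c s) : f x ≤ f y := by
  obtain ⟨ε, hε, h⟩ := exists_mem_polyhedron (y := x - y) hx.1 hs fun v hv => by
    rw [inner_sub_right, hx.2 v hv, hy.2 v hv, sub_self]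
  have := hf _ h
  rw [map_add, map_smul, map_sub, smul_eq_mul] at this
  nlinarith

theorem interior_polyhedron (hz : ∀ v, z v ≠ 0) :
    interior (polyhedron z c) = {x | ∀ v, inner ℝ (z v) x < c v} := by
  apply subset_antisymm
  · intro x hx v
    refine lt_of_le_of_ne (interior_subset hx v) fun h => ?_
    have hcont : Tendsto (fun ε : ℝ => x + ε • z v) (𝓝 0) (𝓝 x) := by
      have : Continuous fun ε : ℝ => x + ε • z v := by fun_prop
      simpa using this.tendsto 0
    have h₁ := (hcont.eventually (mem_interior_iff_mem_nhds.mp hx)).filter_mono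
      (nhdsWithin_le_nhds (s := Set.Ioi 0))
    obtain ⟨ε, hmem, hε⟩ := (h₁.and self_mem_nhdsWithin).exists
    have h₂ := hmem v
    rw [inner_add_right, inner_smul_right, h] at h₂
    have h₃ : 0 < inner ℝ (z v) (z v) := real_inner_self_pos.mpr (hz v)
    have := mul_pos (Set.mem_Ioi.mp hε) h₃
    linarith
  · refine interior_maximal (fun x hx v => (hx v).le) ?_
    have : {x : E3 | ∀ v, inner ℝ (z v) x < c v} = ⋂ v, {x | inner ℝ (z v) x < c v} := by
      ext x; simp
    rw [this]
    exact isOpen_iInter_of_finite fun v => isOpen_lt (by fun_prop) continuous_const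

theorem frontier_polyhedron (hz : ∀ v, z v ≠ 0) :
    frontier (polyhedron z c) = ⋃ v, cell z c {v} := by
  rw [isClosed_polyhedron.frontier_eq, interior_polyhedron hz]
  ext x
  simp only [Set.mem_sdiff, Set.mem_ofPred_eq, Set.mem_iUnion, cell, Finset.mem_singleton,
    forall_eq, not_forall, not_lt]
  constructor
  · rintro ⟨hx, v, hv⟩
    exact ⟨v, hx, le_antisymm (hx v) hv⟩
  · rintro ⟨v, hx, hv⟩
    exact ⟨hx, v, hv.ge⟩

variable [DecidableEq V]

namespace IsDualVertices

/-- The simplex criterion: a linear functional is maximal at the vertex `p t` as soon as it does not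
increase along the edges at `p t`, since these edges span a cone that contains the polyhedron. -/
theorem le_of_vertices (hp : IsDualVertices T z c p) (hT : IsSphereTriangulation T)
    (f : StrongDual ℝ E3) {t : Finset V} (ht : t ∈ triangles T)
    (hf : ∀ t' ∈ triangles T, f (p t') ≤ f (p t)) {x : E3} (hx : x ∈ polyhedron z c) :
    f x ≤ f (p t) := by
  choose! o ho hsub hnot using fun v (hv : v ∈ t) => hT.exists_opposite ht hv
  set l : V → ℝ := fun v => inner ℝ (z v) (x - p t) / inner ℝ (z v) (p (o v) - p t) with hl
  have hneg : ∀ v ∈ t, inner ℝ (z v) (p (o v) - p t) < 0 := fun v hv => by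
    rw [inner_sub_right, hp.inner_eq t ht v hv]
    exact sub_neg.mpr (hp.inner_lt _ (ho v hv) v (hnot v hv))
  have hl0 : ∀ v ∈ t, 0 ≤ l v := fun v hv => by
    refine div_nonneg_of_nonpos ?_ (hneg v hv).le
    rw [inner_sub_right, hp.inner_eq t ht v hv]
    exact sub_nonpos.mpr (hx v)
  have hsum : x - p t - ∑ v ∈ t, l v • (p (o v) - p t) = 0 := by
    refine hp.eq_zero ht fun u hu => ?_
    rw [inner_sub_right, inner_sum, Finset.sum_eq_single_of_mem u hu, inner_smul_right, hl]
    · simp only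
      rw [div_mul_cancel₀ _ (hneg u hu).ne, sub_self]
    · intro v hv hvu
      rw [inner_smul_right, inner_sub_right, hp.inner_eq t ht u hu,
        hp.inner_eq _ (ho v hv) u (hsub v hv (Finset.mem_erase.mpr ⟨hvu.symm, hu⟩)), sub_self,
        mul_zero]
  have hle : f (∑ v ∈ t, l v • (p (o v) - p t)) ≤ 0 := by
    rw [map_sum]
    refine Finset.sum_nonpos fun v hv => ?_
    rw [map_smul, map_sub, smul_eq_mul]
    exact mul_nonpos_of_nonneg_of_nonpos (hl0 v hv) (sub_nonpos.mpr (hf _ (ho v hv)))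
  rw [← sub_eq_zero.mp hsum, map_sub] at hle
  linarith

theorem nonempty_triangles (hT : IsSphereTriangulation T) : (triangles T).Nonempty := by
  obtain ⟨v⟩ := hT.connected.nonempty
  obtain ⟨t, ht, -⟩ := hT.exists_triangle_mem v
  exact ⟨t, ht⟩

theorem exists_max_vertex (hT : IsSphereTriangulation T) (p : Finset V → E3)
    (f : StrongDual ℝ E3) :
    ∃ t ∈ triangles T, ∀ t' ∈ triangles T, f (p t') ≤ f (p t) :=
  Set.exists_max_image (triangles T) (fun t => f (p t)) (Set.toFinite _) (nonempty_triangles hT)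

theorem polyhedron_eq_convexHull (hp : IsDualVertices T z c p) (hT : IsSphereTriangulation T) :
    polyhedron z c = convexHull ℝ (p '' triangles T) := by
  apply subset_antisymm
  · intro x hx
    by_contra hcon
    obtain ⟨f, u, hfu, hux⟩ := geometric_hahn_banach_closed_point (convex_convexHull ℝ _)
      (((Set.toFinite (triangles T)).image p).isClosed_convexHull ℝ) hcon
    obtain ⟨t, ht, hmax⟩ := exists_max_vertex hT p f
    have h₁ := hp.le_of_vertices hT f ht hmax hx
    have h₂ := hfu _ (subset_convexHull ℝ _ ⟨t, ht, rfl⟩)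
    linarith
  · refine convexHull_min ?_ (by simpa using convex_cell (z := z) (c := c) ∅)
    rintro _ ⟨t, ht, rfl⟩
    exact hp.mem_polyhedron ht

theorem isCompact_polyhedron (hp : IsDualVertices T z c p) (hT : IsSphereTriangulation T) :
    IsCompact (polyhedron z c) := by
  rw [hp.polyhedron_eq_convexHull hT]
  exact ((Set.toFinite (triangles T)).image p).isCompact_convexHull ℝ

theorem exists_vertex_lt (hp : IsDualVertices T z c p) (hT : IsSphereTriangulation T)
    {s : Finset V} (hs : s ∈ T.faces) {v : V} (hv : v ∉ s) :
    ∃ x ∈ cell z c s, inner ℝ (z v) x < c v := by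
  obtain ⟨t, ht, hst, hvt⟩ := hT.exists_triangle_notMem hs hv
  exact ⟨p t, hp.mem_cell ht hst, hp.inner_lt t ht v hvt⟩

theorem nonempty_cell (hp : IsDualVertices T z c p) (hT : IsSphereTriangulation T)
    {s : Finset V} (hs : s ∈ T.faces) : (cell z c s).Nonempty := by
  obtain ⟨t, ht, hst, hc⟩ := hT.pure s hs
  exact ⟨p t, hp.mem_cell ⟨ht, hc⟩ hst⟩

/-- The cell of a simplex has a point that lies on no further bounding plane. -/
theorem exists_strict_mem_cell (hp : IsDualVertices T z c p) (hT : IsSphereTriangulation T)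
    {s : Finset V} (hs : s ∈ T.faces) :
    ∃ x ∈ cell z c s, ∀ v ∉ s, inner ℝ (z v) x < c v := by
  obtain ⟨x, hx, h⟩ := exists_strict_point (z := z) (c := c) (convex_cell s)
    (hp.nonempty_cell hT hs) fun _ hx => hx.1
  exact ⟨x, hx, fun v hv => h v (hp.exists_vertex_lt hT hs hv)⟩

theorem exists_interior_point (hp : IsDualVertices T z c p) (hT : IsSphereTriangulation T) :
    ∃ x, ∀ v, inner ℝ (z v) x < c v := by
  obtain ⟨t₀, ht₀⟩ := nonempty_triangles hT
  obtain ⟨x, -, h⟩ := exists_strict_point (z := z) (c := c) (C := polyhedron z c)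
    (by simpa using convex_cell (z := z) (c := c) ∅) ⟨p t₀, hp.mem_polyhedron ht₀⟩
    subset_rfl
  refine ⟨x, fun v => h v ?_⟩
  by_cases hv : v ∈ t₀
  · obtain ⟨t, ht, -, hvt⟩ := hT.exists_opposite ht₀ hv
    exact ⟨p t, hp.mem_polyhedron ht, hp.inner_lt t ht v hvt⟩
  · exact ⟨p t₀, hp.mem_polyhedron ht₀, hp.inner_lt t₀ ht₀ v hv⟩

theorem cell_subset_cell_iff (hp : IsDualVertices T z c p) (hT : IsSphereTriangulation T)
    {s t : Finset V} (ht : t ∈ T.faces) : cell z c t ⊆ cell z c s ↔ s ⊆ t := by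
  constructor
  · intro h v hv
    by_contra hvt
    obtain ⟨x, hx, hlt⟩ := hp.exists_vertex_lt hT ht hvt
    exact hlt.ne ((h hx).2 v hv)
  · exact fun h x hx => ⟨hx.1, fun v hv => hx.2 v (h hv)⟩

theorem cell_injOn (hp : IsDualVertices T z c p) (hT : IsSphereTriangulation T) :
    Set.InjOn (cell z c) T.faces := fun _ hs _ ht h =>
  Finset.Subset.antisymm ((hp.cell_subset_cell_iff hT ht).mp h.ge)
    ((hp.cell_subset_cell_iff hT hs).mp h.le)

theorem dimension_cell (hp : IsDualVertices T z c p) (hT : IsSphereTriangulation T)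
    {s : Finset V} (hs : s ∈ T.faces) : dimension (cell z c s) + s.card = 3 := by
  obtain ⟨t, ht, hst, hc⟩ := hT.pure s hs
  obtain ⟨x, hx, hlt⟩ := hp.exists_strict_mem_cell hT hs
  have : vectorSpan ℝ (cell z c s) = normalSpace z s := by
    apply le_antisymm
    · refine Submodule.span_le.mpr ?_
      rintro _ ⟨a, ha, b, hb, rfl⟩
      refine mem_normalSpace.mpr fun v hv => ?_
      change inner ℝ (z v) (a - b) = 0
      rw [inner_sub_right, ha.2 v hv, hb.2 v hv, sub_self]
    · intro y hy
      rw [mem_normalSpace] at hy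
      obtain ⟨ε, hε, h⟩ := exists_mem_polyhedron (y := y) hx.1 hlt fun v hv => (hy v hv).le
      have hmem : x + ε • y ∈ cell z c s := ⟨h, fun v hv => by
        rw [inner_add_right, inner_smul_right, hy v hv, hx.2 v hv, mul_zero, add_zero]⟩
      have := vsub_mem_vectorSpan ℝ hmem hx
      rw [vsub_eq_sub, add_sub_cancel_left] at this
      simpa [smul_smul, inv_mul_cancel₀ hε.ne'] using Submodule.smul_mem _ ε⁻¹ this
  rw [dimension, this,
    finrank_normalSpace ((hp.linearIndepOn t ⟨ht, hc⟩).mono (Finset.coe_subset.mpr hst))]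

theorem isProperFace_cell (hp : IsDualVertices T z c p) (hT : IsSphereTriangulation T)
    {s : Finset V} (hs : s ∈ T.faces) : IsProperFace (polyhedron z c) (cell z c s) := by
  obtain ⟨y, hy⟩ := hp.nonempty_cell hT hs
  refine ⟨fun _ => ⟨∑ v ∈ s, innerSL ℝ (z v), ?_⟩, ⟨y, hy⟩, ?_⟩
  · have happ : ∀ x, (∑ v ∈ s, innerSL ℝ (z v)) x = ∑ v ∈ s, inner ℝ (z v) x := fun x => by
      simp
    ext x
    simp only [Set.mem_ofPred_eq, happ]
    constructor
    · intro hx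
      refine ⟨hx.1, fun w hw => Finset.sum_le_sum fun v hv => ?_⟩
      rw [hx.2 v hv]
      exact hw v
    · rintro ⟨hx, hmax⟩
      refine ⟨hx, ?_⟩
      have h₁ := hmax y hy.1
      rw [Finset.sum_congr rfl hy.2] at h₁
      exact (Finset.sum_eq_sum_iff_of_le fun v _ => hx v).mp
        (le_antisymm (Finset.sum_le_sum fun v _ => hx v) h₁)
  · intro h
    obtain ⟨x, hx⟩ := hp.exists_interior_point hT
    have hxc : x ∈ cell z c s := by rw [h]; exact fun v => (hx v).le
    obtain ⟨v, hv⟩ := (T.isRelLowerSet_faces hs).1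
    exact (hx v).ne (hxc.2 v hv)

/-- Every proper face is the cell of the set `s` of the bounding planes that contain it; the face
contains a vertex, so that `s` is part of a triangle. -/
theorem exists_cell_eq (hp : IsDualVertices T z c p) (hT : IsSphereTriangulation T)
    {F : Set E3} (hF : IsProperFace (polyhedron z c) F) : ∃ s ∈ T.faces, cell z c s = F := by
  classical
  obtain ⟨hexp, hne, hneq⟩ := hF
  have hconv : Convex ℝ F := hexp.convex (by simpa using convex_cell (z := z) (c := c) ∅)
  obtain ⟨f, hf⟩ := hexp hne
  have hsub : F ⊆ polyhedron z c := hexp.subset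
  obtain ⟨x, hxF, hx⟩ := exists_strict_point hconv hne hsub
  set s : Finset V := Finset.univ.filter fun v => ∀ y ∈ F, inner ℝ (z v) y = c v with hs
  have hms : ∀ v, v ∈ s ↔ ∀ y ∈ F, inner ℝ (z v) y = c v := fun v => by simp [hs]
  have hlt : ∀ v ∉ s, inner ℝ (z v) x < c v := by
    intro v hv
    rw [hms] at hv
    push Not at hv
    obtain ⟨y, hy, hne⟩ := hv
    exact hx v ⟨y, hy, lt_of_le_of_ne (hsub hy v) hne⟩
  have hFs : F ⊆ cell z c s := fun y hy => ⟨hsub hy, fun v hv => (hms v).mp hv y hy⟩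
  have hmax : ∀ w ∈ polyhedron z c, f w ≤ f x := by
    have := hxF
    rw [hf] at this
    exact this.2
  have hcell : cell z c s = F := by
    refine subset_antisymm (fun y hy => ?_) hFs
    rw [hf]
    exact ⟨hy.1, fun w hw => (hmax w hw).trans (le_of_isMax (hFs hxF) hlt f hmax hy)⟩
  refine ⟨s, ?_, hcell⟩
  obtain ⟨t, ht, htmax⟩ := exists_max_vertex hT p f
  have htF : p t ∈ F := by
    rw [hf]
    exact ⟨hp.mem_polyhedron ht, fun w hw => hp.le_of_vertices hT f ht htmax hw⟩
  have hst : s ⊆ t := by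
    intro v hv
    by_contra hvt
    exact (hp.inner_lt t ht v hvt).ne ((hms v).mp hv _ htF)
  refine mem_faces_of_subset ht.1 hst (Finset.nonempty_iff_ne_empty.mpr fun h => hneq ?_)
  rw [← hcell, h, cell_empty]

theorem isDualDecomposition (hp : IsDualVertices T z c p) (hT : IsSphereTriangulation T)
    (hz : ∀ v, z v ≠ 0) : IsDualDecomposition T (polyhedron z c) (cell z c) where
  bijOn := ⟨fun _ hs => hp.isProperFace_cell hT hs, hp.cell_injOn hT,
    fun _ hF => hp.exists_cell_eq hT hF⟩
  subset_iff _ _ _ ht := (hp.cell_subset_cell_iff hT ht).symm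
  dimension_add _ hs := hp.dimension_cell hT hs
  frontier_eq := frontier_polyhedron hz

end IsDualVertices

end Polyhedron

/-! ### Disks and half-spaces -/

section Disks

open Filter Topology

theorem exists_ne_zero_orthogonal (a b : E3) :
    ∃ d : E3, d ≠ 0 ∧ inner ℝ a d = 0 ∧ inner ℝ b d = 0 := by
  classical
  have h := (Submodule.span ℝ (({a, b} : Finset E3) : Set E3)).finrank_add_finrank_orthogonal
  have h' := (finrank_span_finset_le_card (R := ℝ) ({a, b} : Finset E3)).trans Finset.card_le_two
  have h₃ : Module.finrank ℝ E3 = 3 := finrank_euclideanSpace_fin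
  rw [Set.finrank] at h'
  have hne : (Submodule.span ℝ (({a, b} : Finset E3) : Set E3))ᗮ ≠ ⊥ := by
    intro hbot
    rw [hbot, finrank_bot] at h
    omega
  obtain ⟨d, hd, hd0⟩ := Submodule.exists_mem_ne_zero_of_ne_bot hne
  rw [Submodule.mem_orthogonal] at hd
  exact ⟨d, hd0, hd a (Submodule.subset_span (by simp)), hd b (Submodule.subset_span (by simp))⟩

/-- A ray that starts inside the unit ball hits the unit sphere. -/
theorem exists_norm_add_smul_eq_one {x d : E3} (hx : ‖x‖ < 1) (hd : d ≠ 0) :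
    ∃ s : ℝ, 0 < s ∧ ‖x + s • d‖ = 1 := by
  have hd' : 0 < ‖d‖ := norm_pos_iff.mpr hd
  have hcont : ContinuousOn (fun s : ℝ => ‖x + s • d‖) (Set.Icc 0 (2 / ‖d‖)) :=
    Continuous.continuousOn (by fun_prop)
  have h₀ : ‖x + (0 : ℝ) • d‖ ≤ 1 := by simpa using hx.le
  have h₁ : 1 ≤ ‖x + (2 / ‖d‖) • d‖ := by
    have h := norm_sub_le (x + (2 / ‖d‖) • d) x
    rw [add_sub_cancel_left, norm_smul, Real.norm_of_nonneg (by positivity),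
      div_mul_cancel₀ _ hd'.ne'] at h
    linarith
  obtain ⟨s, hs, hs'⟩ := intermediate_value_Icc (by positivity) hcont ⟨h₀, h₁⟩
  refine ⟨s, lt_of_le_of_ne hs.1 fun h => ?_, hs'⟩
  simp only [← h, zero_smul, add_zero] at hs'
  exact hx.ne hs'

namespace SphericalDisk

variable (D : SphericalDisk)

theorem norm_center : ‖D.center‖ = 1 := mem_sphere_zero_iff_norm.mp D.center_mem

theorem inner_center_self : inner ℝ D.center D.center = 1 := by
  rw [real_inner_self_eq_norm_sq, D.norm_center, one_pow]

theorem center_ne_zero : D.center ≠ 0 := norm_pos_iff.mp (by rw [D.norm_center]; exact one_pos)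

theorem sin_radius_pos : 0 < Real.sin D.radius :=
  Real.sin_pos_of_pos_of_lt_pi D.radius_pos D.radius_lt

theorem mem_carrier_iff {x : E3} :
    x ∈ D.carrier ↔ ‖x‖ = 1 ∧ Real.cos D.radius ≤ inner ℝ D.center x := by
  have hS : x ∈ S2 ↔ ‖x‖ = 1 := mem_sphere_zero_iff_norm
  change (x ∈ S2 ∧ _) ↔ _
  rw [hS]
  refine and_congr_right fun hx => ?_
  rw [← Real.strictAntiOn_cos.le_iff_ge ⟨D.radius_pos.le, D.radius_lt.le⟩
    ⟨InnerProductGeometry.angle_nonneg _ _, InnerProductGeometry.angle_le_pi _ _⟩,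
    InnerProductGeometry.cos_angle, hx, D.norm_center, one_mul, div_one, real_inner_comm]

theorem mem_halfSpace_iff {x : E3} :
    x ∈ D.halfSpace ↔ ‖x‖ < 1 ∧ inner ℝ D.center x ≤ Real.cos D.radius := by
  have hH : x ∈ H3 ↔ ‖x‖ < 1 := mem_ball_zero_iff
  change (x ∈ H3 ∧ _) ↔ _
  rw [hH]
  refine and_congr_right fun hx => ⟨fun h => ?_, fun h => ?_⟩
  · have hsub : S2 \ D.carrier ⊆ {y | inner ℝ D.center y ≤ Real.cos D.radius} := by
      rintro y ⟨hy, hy'⟩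
      rw [mem_carrier_iff] at hy'
      by_contra hcon
      exact hy' ⟨mem_sphere_zero_iff_norm.mp hy, (not_le.mp hcon).le⟩
    refine closedConvexHull_min hsub ?_ ?_ h
    · exact convex_halfSpace_le (innerSL ℝ D.center).toLinearMap.isLinear _
    · exact isClosed_le (by fun_prop) continuous_const
  · -- a chord orthogonal to the axis joins two points outside the disk
    have hstrict : ∀ y : E3, ‖y‖ < 1 → inner ℝ D.center y < Real.cos D.radius →
        y ∈ closedConvexHull ℝ (S2 \ D.carrier) := by
      intro y hy hlt
      obtain ⟨d, hd, hzd, -⟩ := exists_ne_zero_orthogonal D.center D.center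
      obtain ⟨s, hs, hs'⟩ := exists_norm_add_smul_eq_one hy hd
      obtain ⟨r, hr, hr'⟩ := exists_norm_add_smul_eq_one hy (neg_ne_zero.mpr hd)
      have hmem : ∀ (e : E3), inner ℝ D.center e = 0 → ‖y + e‖ = 1 →
          y + e ∈ closedConvexHull ℝ (S2 \ D.carrier) := by
        intro e he hn
        refine subset_closedConvexHull ⟨mem_sphere_zero_iff_norm.mpr hn, fun hc => ?_⟩
        have := (D.mem_carrier_iff.mp hc).2
        rw [inner_add_right, he] at this
        linarith
      have h₁ := hmem (s • d) (by rw [inner_smul_right, hzd, mul_zero]) hs'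
      have h₂ := hmem (r • -d) (by rw [inner_smul_right, inner_neg_right, hzd]; simp) hr'
      have h₃ := convex_closedConvexHull h₁ h₂ (a := r / (s + r)) (b := s / (s + r))
        (by positivity) (by positivity) (by field_simp; ring)
      convert h₃ using 1
      have : s + r ≠ 0 := by positivity
      match_scalars <;> field_simp <;> ring
    have hcont : Continuous fun ε : ℝ => x + ε • -D.center := by fun_prop
    have htend : Tendsto (fun ε : ℝ => x + ε • -D.center) (𝓝[>] 0) (𝓝 x) := by
      have := hcont.tendsto 0
      simp only [zero_smul, add_zero] at this
      exact this.mono_left nhdsWithin_le_nhds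
    have hnorm : ∀ᶠ ε : ℝ in 𝓝[>] 0, ‖x + ε • -D.center‖ < 1 :=
      htend.norm.eventually_lt_const hx
    refine isClosed_closedConvexHull.mem_of_tendsto htend ?_
    filter_upwards [hnorm, self_mem_nhdsWithin] with ε h₁ (h₂ : 0 < ε)
    refine hstrict _ h₁ ?_
    rw [inner_add_right, inner_smul_right, inner_neg_right, D.inner_center_self]
    linarith

theorem mem_plane_iff {x : E3} :
    x ∈ D.plane ↔ ‖x‖ < 1 ∧ inner ℝ D.center x = Real.cos D.radius := by
  have hH : x ∈ H3 ↔ ‖x‖ < 1 := mem_ball_zero_iff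
  change (x ∈ H3 ∧ _) ↔ _
  rw [hH]
  refine and_congr_right fun hx => ?_
  have hset : D.halfSpace = Metric.ball 0 1 ∩ {y | inner ℝ D.center y ≤ Real.cos D.radius} := by
    ext y
    rw [mem_halfSpace_iff, Set.mem_inter_iff, mem_ball_zero_iff]
    rfl
  have hset' : {y : E3 | inner ℝ D.center y ≤ Real.cos D.radius} =
      polyhedron (fun _ : Unit => D.center) (fun _ => Real.cos D.radius) := by
    ext y; simp [polyhedron]
  have hmem : x ∈ Metric.ball (0 : E3) 1 := mem_ball_zero_iff.mpr hx
  have hfr := frontier_inter_open_inter (s := {y : E3 | inner ℝ D.center y ≤ Real.cos D.radius})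
    (t := Metric.ball (0 : E3) 1) Metric.isOpen_ball
  have hiff := Set.ext_iff.mp hfr x
  rw [Set.mem_inter_iff, Set.mem_inter_iff, and_iff_left hmem, and_iff_left hmem] at hiff
  rw [hset, Set.inter_comm, hiff, hset', frontier_polyhedron fun _ => D.center_ne_zero]
  simp only [cell, polyhedron, Set.mem_iUnion, Set.mem_ofPred_eq, Finset.mem_singleton,
    exists_const, forall_const]
  exact ⟨fun h => h.2, fun h => ⟨h.le, h⟩⟩

theorem inner_center_eq (D' : SphericalDisk) :
    inner ℝ D.center D'.center = Real.cos D.radius * Real.cos D'.radius -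
      Real.sin D.radius * Real.sin D'.radius * inversiveDistance D D' := by
  rw [inversiveDistance, mul_div_cancel₀ _ (mul_pos D.sin_radius_pos D'.sin_radius_pos).ne',
    InnerProductGeometry.cos_angle, D.norm_center, D'.norm_center]
  ring

end SphericalDisk

/-! ### The Gram matrix of a triangle -/

theorem cos_overlapAngle {D D' : SphericalDisk} (h₀ : 0 < overlapAngle D D')
    (h₁ : overlapAngle D D' < Real.pi) :
    Real.cos (overlapAngle D D') = inversiveDistance D D' ∧ -1 < inversiveDistance D D' ∧
      inversiveDistance D D' < 1 := by
  have h₂ : inversiveDistance D D' < 1 := Real.arccos_pos.mp h₀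
  have h₃ : -1 < inversiveDistance D D' := by
    by_contra h
    exact h₁.ne (Real.arccos_eq_pi.mpr (not_lt.mp h))
  exact ⟨Real.cos_arccos h₃.le h₂.le, h₃, h₂⟩

/-- The Gram determinant of a spherical triangle with angles `α`, `β`, `γ` is positive. -/
theorem gram_det_pos {α β γ : ℝ} (hβ₀ : 0 < β) (hβ₁ : β < Real.pi)
    (h₁ : Real.pi < α + β + γ)
    (h₂ : α + β < γ + Real.pi) (h₃ : β + γ < α + Real.pi) (h₄ : γ + α < β + Real.pi) :
    0 < 1 - Real.cos α ^ 2 - Real.cos β ^ 2 - Real.cos γ ^ 2 -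
      2 * Real.cos α * Real.cos β * Real.cos γ := by
  have e₁ : Real.cos β < -Real.cos (α + γ) := by
    rw [← Real.cos_pi_sub, ← Real.cos_abs (Real.pi - _)]
    exact Real.cos_lt_cos_of_nonneg_of_le_pi (abs_nonneg _) hβ₁.le
      (abs_lt.mpr ⟨by linarith, by linarith⟩)
  have e₂ : -Real.cos β < Real.cos (α - γ) := by
    rw [← Real.cos_pi_sub, ← Real.cos_abs (α - γ)]
    exact Real.cos_lt_cos_of_nonneg_of_le_pi (abs_nonneg _) (by linarith)
      (abs_lt.mpr ⟨by linarith, by linarith⟩)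
  have h := mul_pos (sub_pos.mpr e₁) (sub_pos.mpr e₂)
  rw [Real.cos_add, Real.cos_sub] at h
  have : (-(Real.cos α * Real.cos γ - Real.sin α * Real.sin γ) - Real.cos β) *
      (Real.cos α * Real.cos γ + Real.sin α * Real.sin γ - -Real.cos β) =
      1 - Real.cos α ^ 2 - Real.cos β ^ 2 - Real.cos γ ^ 2 -
      2 * Real.cos α * Real.cos β * Real.cos γ := by
    have hs : Real.sin α ^ 2 * Real.sin γ ^ 2 = (1 - Real.cos α ^ 2) * (1 - Real.cos γ ^ 2) := by
      rw [← Real.sin_sq, ← Real.sin_sq]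
    linear_combination hs
  rwa [this] at h

/-- A ternary quadratic form with unit diagonal and positive leading minors is positive. -/
theorem eq_zero_of_form_nonpos {A B C x y w : ℝ} (hA₀ : -1 < A) (hA₁ : A < 1)
    (hdet : 0 < 1 - A ^ 2 - B ^ 2 - C ^ 2 - 2 * A * B * C)
    (h : x ^ 2 + y ^ 2 + w ^ 2 - 2 * A * x * y - 2 * B * y * w - 2 * C * w * x ≤ 0) :
    x = 0 ∧ y = 0 ∧ w = 0 := by
  have hA : 0 < 1 - A ^ 2 := by nlinarith
  have key : (1 - A ^ 2) *
      (x ^ 2 + y ^ 2 + w ^ 2 - 2 * A * x * y - 2 * B * y * w - 2 * C * w * x) =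
      (1 - A ^ 2) * (x - A * y - C * w) ^ 2 + ((1 - A ^ 2) * y - (B + A * C) * w) ^ 2 +
      (1 - A ^ 2 - B ^ 2 - C ^ 2 - 2 * A * B * C) * w ^ 2 := by ring
  have hle := mul_nonpos_of_nonneg_of_nonpos hA.le h
  rw [key] at hle
  have p₁ := mul_nonneg hA.le (sq_nonneg (x - A * y - C * w))
  have p₂ := sq_nonneg ((1 - A ^ 2) * y - (B + A * C) * w)
  have p₃ := mul_nonneg hdet.le (sq_nonneg w)
  have hw : w = 0 := by
    have : (1 - A ^ 2 - B ^ 2 - C ^ 2 - 2 * A * B * C) * w ^ 2 = 0 := by linarith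
    simpa using (mul_eq_zero.mp this).resolve_left hdet.ne'
  have hy : y = 0 := by
    have : ((1 - A ^ 2) * y - (B + A * C) * w) ^ 2 = 0 := by linarith
    rw [hw, mul_zero, sub_zero] at this
    exact (mul_eq_zero.mp (pow_eq_zero_iff (two_ne_zero) |>.mp this)).resolve_left hA.ne'
  have hx : x = 0 := by
    have : (1 - A ^ 2) * (x - A * y - C * w) ^ 2 = 0 := by linarith
    simpa [hw, hy] using (mul_eq_zero.mp this).resolve_left hA.ne'
  exact ⟨hx, hy, hw⟩

/-- Three disks whose overlap angles are the angles of a spherical triangle: the Lorentzian form is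
positive definite on the span of the normal vectors `(center, cos radius)` of their planes. -/
theorem eq_zero_of_norm_le {D₁ D₂ D₃ : SphericalDisk}
    (h₁ : Real.pi < overlapAngle D₁ D₂ + overlapAngle D₂ D₃ + overlapAngle D₃ D₁)
    (h₂ : overlapAngle D₁ D₂ + overlapAngle D₂ D₃ < overlapAngle D₃ D₁ + Real.pi)
    (h₃ : overlapAngle D₂ D₃ + overlapAngle D₃ D₁ < overlapAngle D₁ D₂ + Real.pi)
    (h₄ : overlapAngle D₃ D₁ + overlapAngle D₁ D₂ < overlapAngle D₂ D₃ + Real.pi) {a b e : ℝ}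
    (h : ‖a • D₁.center + b • D₂.center + e • D₃.center‖ ^ 2 ≤
      (a * Real.cos D₁.radius + b * Real.cos D₂.radius + e * Real.cos D₃.radius) ^ 2) :
    a = 0 ∧ b = 0 ∧ e = 0 := by
  obtain ⟨c₁, l₁, u₁⟩ := cos_overlapAngle (D := D₁) (D' := D₂) (by linarith) (by linarith)
  obtain ⟨c₂, -, -⟩ := cos_overlapAngle (D := D₂) (D' := D₃) (by linarith) (by linarith)
  obtain ⟨c₃, -, -⟩ := cos_overlapAngle (D := D₃) (D' := D₁) (by linarith) (by linarith)
  have hdet := gram_det_pos (by linarith) (by linarith) h₁ h₂ h₃ h₄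
  rw [c₁, c₂, c₃] at hdet
  have i₁ := D₁.inner_center_eq D₂
  have i₂ := D₂.inner_center_eq D₃
  have i₃ := D₃.inner_center_eq D₁
  have s₁ := Real.sin_sq_add_cos_sq D₁.radius
  have s₂ := Real.sin_sq_add_cos_sq D₂.radius
  have s₃ := Real.sin_sq_add_cos_sq D₃.radius
  have hform := eq_zero_of_form_nonpos (x := a * Real.sin D₁.radius) (y := b * Real.sin D₂.radius)
    (w := e * Real.sin D₃.radius) l₁ u₁ hdet (by
      rw [← real_inner_self_eq_norm_sq] at h
      simp only [inner_add_left, inner_add_right, real_inner_smul_left, real_inner_smul_right,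
        SphericalDisk.inner_center_self, real_inner_comm D₁.center D₂.center,
        real_inner_comm D₂.center D₃.center, real_inner_comm D₃.center D₁.center] at h
      simp only [i₁, i₂, i₃] at h
      linear_combination h + a ^ 2 * s₁ + b ^ 2 * s₂ + e ^ 2 * s₃)
  obtain ⟨ha, hb, he⟩ := hform
  exact ⟨(mul_eq_zero.mp ha).resolve_right D₁.sin_radius_pos.ne',
    (mul_eq_zero.mp hb).resolve_right D₂.sin_radius_pos.ne',
    (mul_eq_zero.mp he).resolve_right D₃.sin_radius_pos.ne'⟩

end Disks

/-! ### The vertices of the polyhedron -/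

section Pattern

variable {V : Type*} [DecidableEq V] {T : AbstractSimplicialComplex V} {P : V → SphericalDisk}

theorem ConditionC2.eq_zero_of_norm_le (hc2 : ConditionC2 T P) {i j k : V} (hij : i ≠ j)
    (hjk : j ≠ k) (hki : k ≠ i) (ht : ({i, j, k} : Finset V) ∈ T.faces) {a b e : ℝ}
    (h : ‖a • (P i).center + b • (P j).center + e • (P k).center‖ ^ 2 ≤
      (a * Real.cos (P i).radius + b * Real.cos (P j).radius + e * Real.cos (P k).radius) ^ 2) :
    a = 0 ∧ b = 0 ∧ e = 0 := by
  obtain ⟨h₁, h₂, h₃, h₄⟩ := hc2 i j k hij hjk hki ht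
  exact CirclePattern.eq_zero_of_norm_le h₁ h₂ h₃ h₄ h

theorem ConditionC2.linearIndepOn (hc2 : ConditionC2 T P) {t : Finset V} (ht : t ∈ triangles T) :
    LinearIndepOn ℝ (fun v => (P v).center) (t : Set V) := by
  obtain ⟨i, j, k, hij, hik, hjk, rfl⟩ := Finset.card_eq_three.mp ht.2
  rw [linearIndepOn_finset_iff]
  intro f hf
  rw [Finset.sum_insert (by simp [hij, hik]), Finset.sum_pair hjk, ← add_assoc] at hf
  obtain ⟨h₁, h₂, h₃⟩ := hc2.eq_zero_of_norm_le hij hjk hik.symm ht.1 (a := f i) (b := f j)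
    (e := f k) (by rw [hf, norm_zero, zero_pow two_ne_zero]; exact sq_nonneg _)
  simp [h₁, h₂, h₃]

/-- The planes of the three disks of a triangle meet in a point of hyperbolic space. With
`p = ∑ aᵥ zᵥ`, the Lorentzian vector `∑ aᵥ (zᵥ, cos rᵥ)` is `(p, ‖p‖²)`, and its norm
`‖p‖² - ‖p‖⁴` is positive. -/
theorem ConditionC2.exists_vertex (hc2 : ConditionC2 T P) {t : Finset V} (ht : t ∈ triangles T) :
    ∃ p : E3, ‖p‖ < 1 ∧ ∀ v ∈ t, inner ℝ (P v).center p = Real.cos (P v).radius := by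
  obtain ⟨i, j, k, hij, hik, hjk, rfl⟩ := Finset.card_eq_three.mp ht.2
  have hpos := fun (a b e : ℝ) h => hc2.eq_zero_of_norm_le (a := a) (b := b) (e := e) hij hjk
    hik.symm ht.1 h
  set z : Fin 3 → E3 := ![(P i).center, (P j).center, (P k).center] with hz
  let S : (Fin 3 → ℝ) →ₗ[ℝ] E3 := Fintype.linearCombination ℝ z
  let G : (Fin 3 → ℝ) →ₗ[ℝ] (Fin 3 → ℝ) := LinearMap.pi fun l => (innerSL ℝ (z l)).toLinearMap ∘ₗ S
  have hG : ∀ a l, G a l = inner ℝ (z l) (S a) := fun a l => rfl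
  have hS : ∀ a, S a = a 0 • (P i).center + a 1 • (P j).center + a 2 • (P k).center := fun a => by
    simp [S, Fintype.linearCombination_apply, Fin.sum_univ_three, hz]
  have hnorm : ∀ a, ‖S a‖ ^ 2 = a 0 * G a 0 + a 1 * G a 1 + a 2 * G a 2 := fun a => by
    have h : inner ℝ (S a) (S a) = inner ℝ (a 0 • (P i).center + a 1 • (P j).center +
        a 2 • (P k).center) (S a) := by rw [← hS]
    rw [← real_inner_self_eq_norm_sq, h, inner_add_left, inner_add_left, real_inner_smul_left,
      real_inner_smul_left, real_inner_smul_left]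
    rfl
  have hinj : Function.Injective G := by
    refine (injective_iff_map_eq_zero G).mpr fun a ha => ?_
    have h0 : ‖S a‖ ^ 2 = 0 := by rw [hnorm, ha]; simp
    obtain ⟨h₁, h₂, h₃⟩ := hpos (a 0) (a 1) (a 2) (by rw [← hS, h0]; exact sq_nonneg _)
    ext l
    fin_cases l <;> assumption
  obtain ⟨a, ha⟩ := LinearMap.injective_iff_surjective.mp hinj
    ![Real.cos (P i).radius, Real.cos (P j).radius, Real.cos (P k).radius]
  have hn := hnorm a
  refine ⟨S a, ?_, ?_⟩
  · by_contra hcon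
    rw [not_lt] at hcon
    rw [ha] at hn
    simp only [Matrix.cons_val_zero, Matrix.cons_val_one, Matrix.cons_val] at hn
    obtain ⟨h₁, h₂, h₃⟩ := hpos (a 0) (a 1) (a 2) (by
      rw [← hS, ← hn]
      exact le_self_pow₀ (one_le_pow₀ hcon) two_ne_zero)
    rw [h₁, h₂, h₃] at hn
    nlinarith
  · have h := fun l => (hG a l).symm.trans (congrFun ha l)
    intro v hv
    simp only [Finset.mem_insert, Finset.mem_singleton] at hv
    rcases hv with rfl | rfl | rfl
    exacts [h 0, h 1, h 2]

/-- If a point `p` on the planes of `D₁` and `D₂` is not strictly inside the half-space of `D₃`,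
then one of the two ends of a geodesic through `p` in both planes lies in all three disks. -/
theorem exists_mem_inter_carrier {D₁ D₂ D₃ : SphericalDisk} {p : E3} (hp : ‖p‖ < 1)
    (h₁ : inner ℝ D₁.center p = Real.cos D₁.radius) (h₂ : inner ℝ D₂.center p = Real.cos D₂.radius)
    (h₃ : Real.cos D₃.radius ≤ inner ℝ D₃.center p) :
    (D₁.carrier ∩ D₂.carrier ∩ D₃.carrier).Nonempty := by
  obtain ⟨d, hd, hd₁, hd₂, hd₃⟩ : ∃ d : E3, d ≠ 0 ∧ inner ℝ D₁.center d = 0 ∧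
      inner ℝ D₂.center d = 0 ∧ 0 ≤ inner ℝ D₃.center d := by
    obtain ⟨d, hd, hd₁, hd₂⟩ := exists_ne_zero_orthogonal D₁.center D₂.center
    rcases le_total 0 (inner ℝ D₃.center d) with h | h
    · exact ⟨d, hd, hd₁, hd₂, h⟩
    · exact ⟨-d, neg_ne_zero.mpr hd, by rw [inner_neg_right, hd₁, neg_zero],
        by rw [inner_neg_right, hd₂, neg_zero], by rw [inner_neg_right]; linarith⟩
  obtain ⟨s, hs, hs'⟩ := exists_norm_add_smul_eq_one hp hd
  refine ⟨p + s • d, ⟨?_, ?_⟩, ?_⟩ <;> rw [SphericalDisk.mem_carrier_iff] <;>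
    refine ⟨hs', ?_⟩ <;> rw [inner_add_right, inner_smul_right]
  · rw [h₁, hd₁, mul_zero, add_zero]
  · rw [h₂, hd₂, mul_zero, add_zero]
  · exact h₃.trans (le_add_of_nonneg_right (mul_nonneg hs.le hd₃))

variable [Fintype V]

/-- The vertex of a triangle lies strictly inside the half-spaces of all other disks. Otherwise the
disk of a further vertex `x` meets the three disks of the triangle in pairs, so that by `(cr)` the
triangulation is the boundary of a tetrahedron. -/
theorem inner_lt_of_notMem (hT : IsSphereTriangulation T) (hV : 4 < Fintype.card V)
    (hP : contactGraph P = oneSkeleton T) (hcr : ConditionCR T P) {t : Finset V}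
    (ht : t ∈ triangles T) {p : E3} (hp : ‖p‖ < 1)
    (hpt : ∀ v ∈ t, inner ℝ (P v).center p = Real.cos (P v).radius) {x : V} (hx : x ∉ t) :
    inner ℝ (P x).center p < Real.cos (P x).radius := by
  by_contra hcon
  rw [not_lt] at hcon
  have hne : ∀ u ∈ t, u ≠ x := fun u hu h => hx (h ▸ hu)
  have hadj : ∀ u ∈ t, (oneSkeleton T).Adj u x := by
    intro u hu
    rw [← hP]
    obtain ⟨q, ⟨hq, -⟩, hq'⟩ := exists_mem_inter_carrier hp (hpt u hu) (hpt u hu) hcon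
    exact ⟨hne u hu, q, hq, hq'⟩
  have hface : ∀ u ∈ t, ∀ w ∈ t, u ≠ w → ({u, w, x} : Finset V) ∈ T.faces := by
    intro u hu w hw huw
    refine hT.mem_faces_of_not_separating (adj_of_mem_face ht.1 hu hw huw) (hadj w hw)
      (hadj u hu).symm fun hsep => ?_
    exact (exists_mem_inter_carrier hp (hpt u hu) (hpt w hw) hcon).ne_empty (hcr u w x hsep)
  have := hT.card_le_of_tetrahedron (S := insert x t) (by rw [Finset.card_insert_of_notMem hx, ht.2])
    fun t' ht' hc => by
      by_cases hxt : x ∈ t'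
      · obtain ⟨u, w, huw, huw'⟩ := Finset.card_eq_two.mp
          (show (t'.erase x).card = 2 by rw [Finset.card_erase_of_mem hxt, hc])
        have hsub : ∀ y ∈ t'.erase x, y ∈ t := fun y hy => by
          have := ht' (Finset.mem_of_mem_erase hy)
          exact (Finset.mem_insert.mp this).resolve_left (Finset.ne_of_mem_erase hy)
        have h := hface u (hsub u (by rw [huw']; simp)) w (hsub w (by rw [huw']; simp)) huw
        rw [← Finset.insert_erase hxt, huw']
        convert h using 1
        ext y
        simp only [Finset.mem_insert, Finset.mem_singleton]
        tauto
      · have : t' = t := Finset.eq_of_subset_of_card_le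
          (fun y hy => (Finset.mem_insert.mp (ht' hy)).resolve_left fun h => hxt (h ▸ hy))
          (by rw [hc, ht.2])
        exact this ▸ ht.1
  omega

theorem exists_isDualVertices (hT : IsSphereTriangulation T) (hV : 4 < Fintype.card V)
    (hP : contactGraph P = oneSkeleton T) (hc2 : ConditionC2 T P) (hcr : ConditionCR T P) :
    ∃ p : Finset V → E3, (∀ t ∈ triangles T, ‖p t‖ < 1) ∧
      IsDualVertices T (fun v => (P v).center) (fun v => Real.cos (P v).radius) p := by
  choose! p hp hpt using fun t (ht : t ∈ triangles T) => hc2.exists_vertex ht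
  exact ⟨p, hp, hpt, fun t ht v hv => inner_lt_of_notMem hT hV hP hcr ht (hp t ht) (hpt t ht) hv,
    fun t ht => hc2.linearIndepOn ht⟩

end Pattern

/-! ### The polyhedron of a circle pattern -/

section Cells

variable {V : Type*} {P : V → SphericalDisk}

theorem Q_eq_polyhedron [Nonempty V]
    (h : polyhedron (fun v => (P v).center) (fun v => Real.cos (P v).radius) ⊆ H3) :
    Q P = polyhedron (fun v => (P v).center) (fun v => Real.cos (P v).radius) := by
  ext x
  simp only [Q, Set.mem_iInter, SphericalDisk.mem_halfSpace_iff]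
  refine ⟨fun hx v => (hx v).2, fun hx v => ⟨mem_ball_zero_iff.mp (h hx), hx v⟩⟩

theorem dualCell_eq_cell [Nonempty V]
    (h : polyhedron (fun v => (P v).center) (fun v => Real.cos (P v).radius) ⊆ H3) (s : Finset V) :
    dualCell P s = cell (fun v => (P v).center) (fun v => Real.cos (P v).radius) s := by
  ext x
  simp only [dualCell, Q_eq_polyhedron h, Set.mem_inter_iff, Set.mem_iInter,
    SphericalDisk.mem_plane_iff, cell, Set.mem_ofPred_eq]
  refine and_congr_right fun hx => ⟨fun h' v hv => (h' v hv).2, fun h' v hv => ⟨?_, h' v hv⟩⟩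
  exact mem_ball_zero_iff.mp (h hx)

theorem isHyperbolicHalfSpace_halfSpace (D : SphericalDisk) : IsHyperbolicHalfSpace D.halfSpace := by
  refine ⟨D.center, Real.cos D.radius, D.norm_center, ?_, ?_⟩
  · rw [← sq_lt_one_iff_abs_lt_one]
    nlinarith [Real.sin_sq_add_cos_sq D.radius, pow_pos D.sin_radius_pos 2]
  · ext x
    rw [SphericalDisk.mem_halfSpace_iff, Set.mem_ofPred_eq, H3, mem_ball_zero_iff]

theorem IsDualVertices.polyhedron_subset_H3 [Fintype V] [DecidableEq V]
    {T : AbstractSimplicialComplex V} (hT : IsSphereTriangulation T) {z : V → E3} {c : V → ℝ}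
    {p : Finset V → E3} (hp : IsDualVertices T z c p) (h : ∀ t ∈ triangles T, ‖p t‖ < 1) :
    polyhedron z c ⊆ H3 := by
  rw [hp.polyhedron_eq_convexHull hT]
  refine convexHull_min ?_ (convex_ball 0 1)
  rintro _ ⟨t, ht, rfl⟩
  exact mem_ball_zero_iff.mpr (h t ht)

theorem isCompactConvexPolyhedron_Q [Finite V] [Nonempty V] (h : IsCompact (Q P))
    (h' : (interior (Q P)).Nonempty) (hconv : Convex ℝ (Q P)) :
    IsCompactConvexPolyhedron (Q P) where
  exists_halfSpaces := by
    refine ⟨Set.range fun v => (P v).halfSpace, Set.finite_range _, ?_, ?_⟩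
    · rintro _ ⟨v, rfl⟩
      exact isHyperbolicHalfSpace_halfSpace _
    · rw [Set.sInter_range]
      refine (Set.inter_eq_right.mpr fun x hx => ?_).symm
      exact (Set.mem_iInter.mp hx (Classical.arbitrary V)).1
  convex := hconv
  compact := h
  interior_nonempty := h'

end Cells

/-! ### Dihedral angles -/

section Angles

open Filter Topology

theorem inversiveDistance_comm (D D' : SphericalDisk) :
    inversiveDistance D D' = inversiveDistance D' D := by
  rw [inversiveDistance, inversiveDistance, InnerProductGeometry.angle_comm,
    mul_comm (Real.cos _), mul_comm (Real.sin _)]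

theorem kleinInner_comm (p a b : E3) : kleinInner p a b = kleinInner p b a := by
  rw [kleinInner, kleinInner, real_inner_comm, mul_comm (inner ℝ p a)]

theorem kleinInner_add_left (p a a' b : E3) :
    kleinInner p (a + a') b = kleinInner p a b + kleinInner p a' b := by
  simp only [kleinInner, inner_add_left, inner_add_right]
  ring

theorem kleinInner_smul_left (p a b : E3) (r : ℝ) :
    kleinInner p (r • a) b = r * kleinInner p a b := by
  simp only [kleinInner, real_inner_smul_left, real_inner_smul_right]
  ring

theorem kleinInner_smul_right (p a b : E3) (r : ℝ) :
    kleinInner p a (r • b) = r * kleinInner p a b := by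
  rw [kleinInner_comm, kleinInner_smul_left, kleinInner_comm]

theorem kleinInner_sub_left (p a a' b : E3) :
    kleinInner p (a - a') b = kleinInner p a b - kleinInner p a' b := by
  rw [sub_eq_add_neg, kleinInner_add_left, ← neg_one_smul ℝ a', kleinInner_smul_left]
  ring

theorem one_sub_norm_sq_pos {p : E3} (hp : ‖p‖ < 1) : 0 < 1 - ‖p‖ ^ 2 := by
  nlinarith [norm_nonneg p]

theorem kleinInner_self_pos {p a : E3} (hp : ‖p‖ < 1) (ha : a ≠ 0) : 0 < kleinInner p a a := by
  have h := one_sub_norm_sq_pos hp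
  have h' : 0 < inner ℝ a a := real_inner_self_pos.mpr ha
  exact add_pos_of_pos_of_nonneg (div_pos h' h) (div_nonneg (mul_self_nonneg _) (by positivity))

/-- The hyperbolic gradient at `p` of the linear function `⟪z, ·⟫`. -/
noncomputable def kleinGradient (p z : E3) : E3 := (1 - ‖p‖ ^ 2) • (z - (inner ℝ p z : ℝ) • p)

theorem kleinInner_kleinGradient {p : E3} (hp : ‖p‖ < 1) (z y : E3) :
    kleinInner p (kleinGradient p z) y = inner ℝ z y := by
  have h := (one_sub_norm_sq_pos hp).ne'
  rw [kleinInner, kleinGradient, real_inner_smul_left, real_inner_smul_right, inner_sub_left,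
    inner_sub_right, real_inner_smul_left, real_inner_smul_right, real_inner_self_eq_norm_sq]
  field_simp
  ring

theorem inner_kleinGradient (p z z' : E3) :
    inner ℝ z (kleinGradient p z') =
      (1 - ‖p‖ ^ 2) * (inner ℝ z z' - inner ℝ z p * inner ℝ z' p) := by
  rw [kleinGradient, real_inner_smul_right, inner_sub_right, real_inner_smul_right,
    real_inner_comm z' p]
  ring

/-- At a point `p` on the planes of the disks `D` and `D'`, a vector tangent to the plane of `D` and
hyperbolically orthogonal to the intersection of the two planes that points into the half-space of
`D'`. It is a combination of the gradients of the two linear functions `⟪center, ·⟫`; the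
coefficients make it tangent to the plane of `D`. -/
noncomputable def inwardDirection (D D' : SphericalDisk) (p : E3) : E3 :=
  (-(Real.sin D'.radius)⁻¹) • kleinGradient p D'.center +
    (-(inversiveDistance D D' / Real.sin D.radius)) • kleinGradient p D.center

theorem kleinInner_inwardDirection {p : E3} (hp : ‖p‖ < 1) (D D' : SphericalDisk) (y : E3) :
    kleinInner p (inwardDirection D D' p) y = -(Real.sin D'.radius)⁻¹ * inner ℝ D'.center y -
      inversiveDistance D D' / Real.sin D.radius * inner ℝ D.center y := by
  rw [inwardDirection, kleinInner_add_left, kleinInner_smul_left, kleinInner_smul_left,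
    kleinInner_kleinGradient hp, kleinInner_kleinGradient hp]
  ring

section

variable {D D' : SphericalDisk} {p : E3} (h : inner ℝ D.center p = Real.cos D.radius)
  (h' : inner ℝ D'.center p = Real.cos D'.radius)

include h h'

theorem inner_inwardDirection_left : inner ℝ D.center (inwardDirection D D' p) = 0 := by
  have hs := D.sin_radius_pos.ne'
  have hs' := D'.sin_radius_pos.ne'
  rw [inwardDirection, inner_add_right, real_inner_smul_right, real_inner_smul_right,
    inner_kleinGradient, inner_kleinGradient, D.inner_center_eq D', D.inner_center_self, h, h']
  field_simp
  have := Real.sin_sq_add_cos_sq D.radius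
  linear_combination (Real.sin D'.radius * inversiveDistance D D' * (1 - ‖p‖ ^ 2)) * this

theorem inner_inwardDirection_right : inner ℝ D'.center (inwardDirection D D' p) =
    -((1 - ‖p‖ ^ 2) * Real.sin D'.radius * (1 - inversiveDistance D D' ^ 2)) := by
  have hs := D.sin_radius_pos.ne'
  have hs' := D'.sin_radius_pos.ne'
  rw [inwardDirection, inner_add_right, real_inner_smul_right, real_inner_smul_right,
    inner_kleinGradient, inner_kleinGradient, D'.inner_center_eq D, D'.inner_center_self, h, h',
    inversiveDistance_comm D' D]
  field_simp
  have := Real.sin_sq_add_cos_sq D'.radius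
  linear_combination (Real.sin D.radius * (1 - ‖p‖ ^ 2)) * this

theorem kleinInner_inwardDirection_self (hp : ‖p‖ < 1) :
    kleinInner p (inwardDirection D D' p) (inwardDirection D D' p) =
      (1 - ‖p‖ ^ 2) * (1 - inversiveDistance D D' ^ 2) := by
  rw [kleinInner_inwardDirection hp, inner_inwardDirection_left h h',
    inner_inwardDirection_right h h']
  have hs' := D'.sin_radius_pos.ne'
  field_simp
  ring

theorem kleinInner_inwardDirection_swap (hp : ‖p‖ < 1) :
    kleinInner p (inwardDirection D D' p) (inwardDirection D' D p) =
      inversiveDistance D D' * ((1 - ‖p‖ ^ 2) * (1 - inversiveDistance D D' ^ 2)) := by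
  rw [kleinInner_inwardDirection hp, inner_inwardDirection_left h' h,
    inner_inwardDirection_right h' h, inversiveDistance_comm D' D]
  have hs := D.sin_radius_pos.ne'
  field_simp
  ring

theorem kleinAngle_inwardDirection (hp : ‖p‖ < 1) (h₀ : -1 < inversiveDistance D D')
    (h₁ : inversiveDistance D D' < 1) {r s : ℝ} (hr : 0 < r) (hs : 0 < s) :
    kleinAngle p (r • inwardDirection D D' p) (s • inwardDirection D' D p) =
      overlapAngle D D' := by
  have hm : 0 < (1 - ‖p‖ ^ 2) * (1 - inversiveDistance D D' ^ 2) :=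
    mul_pos (one_sub_norm_sq_pos hp) (by nlinarith)
  rw [kleinAngle, overlapAngle]
  simp only [kleinInner_smul_left, kleinInner_smul_right]
  rw [kleinInner_inwardDirection_self h h' hp, kleinInner_inwardDirection_self h' h hp,
    kleinInner_inwardDirection_swap h h' hp, inversiveDistance_comm D' D, ← mul_assoc r r,
    ← mul_assoc s s, Real.sqrt_mul (mul_self_nonneg r), Real.sqrt_mul (mul_self_nonneg s),
    Real.sqrt_mul_self hr.le, Real.sqrt_mul_self hs.le]
  congr 1
  rw [mul_mul_mul_comm, Real.mul_self_sqrt hm.le, div_eq_iff (mul_pos (mul_pos hr hs) hm).ne']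
  ring

end

/-- A segment that ends in a relatively interior point can be prolonged within the set. -/
theorem exists_add_smul_mem_of_mem_intrinsicInterior {C : Set E3} {x y : E3}
    (hx : x ∈ intrinsicInterior ℝ C) (hy : y ∈ C) : ∃ ε : ℝ, 0 < ε ∧ x + ε • (x - y) ∈ C := by
  obtain ⟨x', hx', rfl⟩ := mem_intrinsicInterior.mp hx
  have hmem : ∀ ε : ℝ, x'.1 + ε • (x'.1 - y) ∈ affineSpan ℝ C := fun ε => by
    have := AffineMap.lineMap_mem (-ε) x'.2 (subset_affineSpan ℝ C hy)
    rw [AffineMap.lineMap_apply] at this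
    convert this using 1
    simp only [vsub_eq_sub, vadd_eq_add]
    module
  have hcont : Continuous fun ε : ℝ => (⟨_, hmem ε⟩ : affineSpan ℝ C) :=
    Continuous.subtype_mk (by fun_prop) _
  have htend := hcont.tendsto 0
  have h0 : (⟨_, hmem 0⟩ : affineSpan ℝ C) = x' := Subtype.ext (by simp)
  rw [h0] at htend
  have h₁ := (htend.eventually (mem_interior_iff_mem_nhds.mp hx')).filter_mono
    (nhdsWithin_le_nhds (s := Set.Ioi 0))
  obtain ⟨ε, h, hε⟩ := (h₁.and self_mem_nhdsWithin).exists
  exact ⟨ε, hε, h⟩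

variable {V : Type*}

theorem inner_lt_of_mem_intrinsicInterior {z : V → E3} {c : V → ℝ} {C : Set E3} {x y : E3} {v : V}
    (hC : C ⊆ polyhedron z c) (hx : x ∈ intrinsicInterior ℝ C) (hy : y ∈ C)
    (hv : inner ℝ (z v) y < c v) : inner ℝ (z v) x < c v := by
  refine lt_of_le_of_ne (hC (intrinsicInterior_subset hx) v) fun h => ?_
  obtain ⟨ε, hε, hmem⟩ := exists_add_smul_mem_of_mem_intrinsicInterior hx hy
  have := hC hmem v
  rw [inner_add_right, inner_smul_right, inner_sub_right, h] at this
  nlinarith [mul_pos hε (sub_pos.mpr hv)]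

variable [DecidableEq V] {P : V → SphericalDisk}

theorem cell_inter_cell {z : V → E3} {c : V → ℝ} (s t : Finset V) :
    cell z c s ∩ cell z c t = cell z c (s ∪ t) := by
  ext x
  simp only [cell, Set.mem_inter_iff, Set.mem_ofPred_eq, Finset.mem_union]
  constructor
  · rintro ⟨⟨h, h₁⟩, -, h₂⟩
    exact ⟨h, fun v hv => hv.elim (h₁ v) (h₂ v)⟩
  · rintro ⟨h, h'⟩
    exact ⟨⟨h, fun v hv => h' v (Or.inl hv)⟩, h, fun v hv => h' v (Or.inr hv)⟩

theorem exists_eq_smul_of_orthogonal_pair {z : V → E3} {u w : V} (huw : u ≠ w)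
    (hz : LinearIndepOn ℝ z (({u, w} : Finset V) : Set V)) {d y : E3} (hd : d ≠ 0)
    (hd₁ : inner ℝ (z u) d = 0) (hd₂ : inner ℝ (z w) d = 0) (hy₁ : inner ℝ (z u) y = 0)
    (hy₂ : inner ℝ (z w) y = 0) : ∃ r : ℝ, y = r • d := by
  have h := finrank_normalSpace hz
  rw [Finset.card_pair huw] at h
  have h₁ : Module.finrank ℝ (normalSpace z {u, w}) = 1 := by omega
  have hmem : ∀ x : E3, inner ℝ (z u) x = 0 → inner ℝ (z w) x = 0 → x ∈ normalSpace z {u, w} :=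
    fun x h₁ h₂ => mem_normalSpace.mpr (by simp [h₁, h₂])
  obtain ⟨r, hr⟩ := (finrank_eq_one_iff_of_nonzero' (⟨d, hmem d hd₁ hd₂⟩ : normalSpace z {u, w})
    fun h => hd (congrArg Subtype.val h)).mp h₁ ⟨y, hmem y hy₁ hy₂⟩
  exact ⟨r, (congrArg Subtype.val hr).symm⟩

/-- At a relatively interior point of an edge, the inward normals of an adjacent face form a
ray. -/
theorem mem_inwardNormals_iff [Fintype V] {u w : V} (huw : u ≠ w)
    (hz : LinearIndepOn ℝ (fun v => (P v).center) (({u, w} : Finset V) : Set V))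
    (h₀ : -1 < inversiveDistance (P u) (P w)) (h₁ : inversiveDistance (P u) (P w) < 1) {p : E3}
    (hp : ‖p‖ < 1)
    (hpe : p ∈ cell (fun v => (P v).center) (fun v => Real.cos (P v).radius) {u, w})
    (hlt : ∀ v ∉ ({u, w} : Finset V), inner ℝ (P v).center p < Real.cos (P v).radius) (a : E3) :
    a ∈ inwardNormals (cell (fun v => (P v).center) (fun v => Real.cos (P v).radius) {u})
      (cell (fun v => (P v).center) (fun v => Real.cos (P v).radius) {u, w}) p ↔
    ∃ r : ℝ, 0 < r ∧ a = r • inwardDirection (P u) (P w) p := by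
  have hu : inner ℝ (P u).center p = Real.cos (P u).radius := hpe.2 u (by simp)
  have hw : inner ℝ (P w).center p = Real.cos (P w).radius := hpe.2 w (by simp)
  have hiu := inner_inwardDirection_left hu hw
  have hiw : inner ℝ (P w).center (inwardDirection (P u) (P w) p) < 0 := by
    rw [inner_inwardDirection_right hu hw]
    have := one_sub_norm_sq_pos hp
    have := (P w).sin_radius_pos
    have : 0 < 1 - inversiveDistance (P u) (P w) ^ 2 := by nlinarith
    exact neg_neg_of_pos (by positivity)
  constructor
  · rintro ⟨ha, horth, ε, hε, hmem⟩
    have hau : inner ℝ (P u).center a = 0 := by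
      have := hmem.2 u (by simp)
      simp only [inner_add_right, inner_smul_right, hu] at this
      exact (mul_eq_zero.mp (by linarith)).resolve_left hε.ne'
    have haw : inner ℝ (P w).center a ≤ 0 := by
      have := hmem.1 w
      simp only [inner_add_right, inner_smul_right, hw] at this
      exact nonpos_of_mul_nonpos_right (by linarith) hε
    obtain ⟨d, hd, hd₁, hd₂⟩ := exists_ne_zero_orthogonal (P u).center (P w).center
    have had : kleinInner p a d = 0 := by
      obtain ⟨δ, hδ, h⟩ := exists_mem_polyhedron (y := d) hpe.1 hlt (by simp [hd₁, hd₂])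
      have := horth (p + δ • d) ⟨h, by simp [inner_add_right, inner_smul_right, hd₁, hd₂, hu, hw]⟩
      rw [add_sub_cancel_left, kleinInner_smul_right] at this
      exact (mul_eq_zero.mp this).resolve_left hδ.ne'
    -- the difference of `a` and a suitable multiple of the inward direction is tangent to both planes
    -- and orthogonal to their intersection, hence zero
    set r := inner ℝ (P w).center a / inner ℝ (P w).center (inwardDirection (P u) (P w) p) with hr
    have h₂ : a - r • inwardDirection (P u) (P w) p = 0 := by
      obtain ⟨k, hk⟩ := exists_eq_smul_of_orthogonal_pair huw hz hd hd₁ hd₂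
        (y := a - r • inwardDirection (P u) (P w) p)
        (by simp only [inner_sub_right, inner_smul_right, hau, hiu, mul_zero, sub_zero])
        (by simp only [inner_sub_right, inner_smul_right, hr, div_mul_cancel₀ _ hiw.ne, sub_self])
      have h₃ : kleinInner p (a - r • inwardDirection (P u) (P w) p) d = 0 := by
        rw [kleinInner_sub_left, kleinInner_smul_left, kleinInner_inwardDirection hp, had, hd₁, hd₂]
        ring
      rw [hk, kleinInner_smul_left] at h₃
      rw [hk, (mul_eq_zero.mp h₃).resolve_right (kleinInner_self_pos hp hd).ne', zero_smul]
    have har := sub_eq_zero.mp h₂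
    refine ⟨r, lt_of_le_of_ne (div_nonneg_of_nonpos haw hiw.le) fun h => ha ?_, har⟩
    rw [har, ← h, zero_smul]
  · rintro ⟨r, hr, rfl⟩
    refine ⟨fun h => ?_, fun x hx => ?_, ?_⟩
    · have : inner ℝ (P w).center (r • inwardDirection (P u) (P w) p) < 0 := by
        rw [inner_smul_right]; exact mul_neg_of_pos_of_neg hr hiw
      rw [h, inner_zero_right] at this
      exact this.false
    · rw [kleinInner_smul_left, kleinInner_inwardDirection hp, inner_sub_right, inner_sub_right,
        hx.2 u (by simp), hx.2 w (by simp), hu, hw]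
      ring
    · obtain ⟨ε, hε, h⟩ := exists_mem_polyhedron (y := r • inwardDirection (P u) (P w) p) hpe.1 hlt
        (by
          intro v hv
          simp only [Finset.mem_insert, Finset.mem_singleton] at hv
          rw [inner_smul_right]
          rcases hv with rfl | rfl
          · rw [hiu, mul_zero]
          · exact (mul_neg_of_pos_of_neg hr hiw).le)
      refine ⟨ε, hε, h, fun v hv => ?_⟩
      rw [Finset.mem_singleton.mp hv]
      simp only [inner_add_right, inner_smul_right, hiu, hu, mul_zero, add_zero]

/-- The dihedral angle along the edge dual to `[u, w]` is the overlap angle. The latter lies strictly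
between `0` and `π` by `(c2)`, so that `arccos` returns no boundary value. -/
theorem hasDihedralAngle_cell [Fintype V] {T : AbstractSimplicialComplex V}
    (hT : IsSphereTriangulation T) (hc2 : ConditionC2 T P) {q : Finset V → E3}
    (hq : IsDualVertices T (fun v => (P v).center) (fun v => Real.cos (P v).radius) q)
    (hsub : polyhedron (fun v => (P v).center) (fun v => Real.cos (P v).radius) ⊆ H3) {u w : V}
    (huw : (oneSkeleton T).Adj u w) :
    HasDihedralAngle (cell (fun v => (P v).center) (fun v => Real.cos (P v).radius) {u})
      (cell (fun v => (P v).center) (fun v => Real.cos (P v).radius) {w})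
      (overlapAngle (P u) (P w)) := by
  obtain ⟨t, ht, hst, hc⟩ := hT.pure _ huw.2
  have hz := (hq.linearIndepOn t ⟨ht, hc⟩).mono (Finset.coe_subset.mpr hst)
  obtain ⟨-, h₀, h₁⟩ : _ ∧ -1 < inversiveDistance (P u) (P w) ∧
      inversiveDistance (P u) (P w) < 1 := by
    obtain ⟨k, hk⟩ : (t \ {u, w}).Nonempty := Finset.card_pos.mp (by
      rw [Finset.card_sdiff_of_subset hst, hc, Finset.card_pair huw.1]; norm_num)
    rw [Finset.mem_sdiff] at hk
    have hkt := eq_insert_of_subset hst hk.1 hk.2 (by rw [hc, Finset.card_pair huw.1])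
    have hk' := hk.2
    simp only [Finset.mem_insert, Finset.mem_singleton, not_or] at hk'
    obtain ⟨a₁, a₂, a₃, a₄⟩ := hc2 k u w hk'.1 huw.1 (Ne.symm hk'.2) (hkt ▸ ht)
    exact cos_overlapAngle (by linarith) (by linarith)
  intro p hp
  rw [cell_inter_cell] at hp ⊢
  change p ∈ intrinsicInterior ℝ (cell _ _ {u, w}) at hp
  have hpe := intrinsicInterior_subset hp
  have hlt : ∀ v ∉ ({u, w} : Finset V), inner ℝ (P v).center p < Real.cos (P v).radius := by
    intro v hv
    obtain ⟨y, hy, hyv⟩ := hq.exists_vertex_lt hT huw.2 hv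
    exact inner_lt_of_mem_intrinsicInterior (z := fun v => (P v).center)
      (c := fun v => Real.cos (P v).radius) (fun x hx => hx.1) hp hy hyv
  have hp1 : ‖p‖ < 1 := mem_ball_zero_iff.mp (hsub hpe.1)
  have hF := mem_inwardNormals_iff huw.1 hz h₀ h₁ hp1 hpe hlt
  have hG := mem_inwardNormals_iff (P := P) huw.1.symm (by rwa [Finset.pair_comm])
    (by rwa [inversiveDistance_comm]) (by rwa [inversiveDistance_comm]) hp1
    (by rwa [Finset.pair_comm]) (by rwa [Finset.pair_comm])
  rw [Finset.pair_comm w u] at hG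
  refine ⟨⟨_, (hF _).mpr ⟨1, one_pos, rfl⟩⟩, ⟨_, (hG _).mpr ⟨1, one_pos, rfl⟩⟩, fun a ha b hb => ?_⟩
  obtain ⟨r, hr, rfl⟩ := (hF a).mp ha
  obtain ⟨s, hs, rfl⟩ := (hG b).mp hb
  exact kleinAngle_inwardDirection (hpe.2 u (by simp)) (hpe.2 w (by simp)) hp1 h₀ h₁ hr hs

end Angles

end CirclePattern

theorem theorem3p1 {V : Type*} [Fintype V] [DecidableEq V]
    (T : AbstractSimplicialComplex V)
    (hT : CirclePattern.IsSphereTriangulation T)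
    (hV : 4 < Fintype.card V)
    (P : V → CirclePattern.SphericalDisk)
    (hP : CirclePattern.contactGraph P = CirclePattern.oneSkeleton T)
    (hc2 : CirclePattern.ConditionC2 T P)
    (hcr : CirclePattern.ConditionCR T P) :
    CirclePattern.IsCompactConvexPolyhedron (CirclePattern.Q P) ∧
    CirclePattern.IsDualDecomposition T (CirclePattern.Q P) (CirclePattern.dualCell P) ∧
    ∀ u w : V, (CirclePattern.oneSkeleton T).Adj u w →
      CirclePattern.HasDihedralAngle
        (CirclePattern.dualCell P {u}) (CirclePattern.dualCell P {w})
        (CirclePattern.overlapAngle (P u) (P w)) := by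
  obtain ⟨p, hp, hdual⟩ := CirclePattern.exists_isDualVertices hT hV hP hc2 hcr
  have hsub := hdual.polyhedron_subset_H3 hT hp
  have : Nonempty V := hT.connected.nonempty
  have hz : ∀ v, (P v).center ≠ 0 := fun v => (P v).center_ne_zero
  have hQ := CirclePattern.Q_eq_polyhedron hsub
  have hcell : CirclePattern.dualCell P = CirclePattern.cell (fun v => (P v).center)
      (fun v => Real.cos (P v).radius) := funext (CirclePattern.dualCell_eq_cell hsub)
  refine ⟨CirclePattern.isCompactConvexPolyhedron_Q ?_ ?_ ?_, ?_, fun u w huw => ?_⟩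
  · rw [hQ]
    exact hdual.isCompact_polyhedron hT
  · rw [hQ, CirclePattern.interior_polyhedron hz]
    exact hdual.exists_interior_point hT
  · rw [hQ, ← CirclePattern.cell_empty]
    exact CirclePattern.convex_cell ∅
  · rw [hQ, hcell]
    exact hdual.isDualDecomposition hT hz
  · rw [hcell]
    exact CirclePattern.hasDihedralAngle_cell hT hc2 hdual hsub huw
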